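/- Let $X_1,X_2,\dots$ be independent, identically distributed non-negative random variables on a probability space $(\Omega,\mathcal A,\mathbf P)$ with cumulative distribution function $F$. Suppose that $\overline F:=1-F$ is regularly varying at infinity with index $-1/\gamma_0$ for some $\gamma_0>0$, i.e. $\overline F(ux)/\overline F(u)\to x^{-1/\gamma_0}$ as $u\to\infty$, for every $x>0$. Write $X_{1:n}\le\dots\le X_{n:n}$ for the order statistics of $X_1,\dots,X_n$. Let $J:\mathbb R\to\mathbb R$ be a weight function such that - [A1] $J$ is continuous, nonincreasing and nonnegative on $(0,1)$, with $\int_0^1J(s)\,ds=1$; - [A2] the derivatives $J^{(m)}$, $1\le m\le3$, exist on $(0,1)$, and they and $J$ are bounded there; - [A3] $J\neq0$ on $(0,1)$, the function $\mathcal L(s):=\frac{J^{(1)}(s)}{J(s)}\log s$ has derivatives $\mathcal L^{(m)}$, $1\le m\le3$, on $(0,1)$, and these and $\mathcal L$ are bounded there. For $\gamma>0$ and $x\ge1$ put $\ell_\gamma(x):=\gamma^{-1}x^{-1-1/\gamma}$ and $\ell_{\gamma,J}(x):=J(x^{-1/\gamma})\,\ell_\gamma(x)$. Let $k=k_n$ be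 a sequence of integers with $k\to\infty$ and $k/n\to0$ as $n\to\infty$, and let $\alpha>0$. Consider the estimating equation in the unknown $\gamma>0$ $$\frac1k\sum_{i=1}^kJ\Big(\frac i{k+1}\Big)\frac{d}{d\gamma}\,\ell_{\gamma,J}^{\alpha}\Big(\frac{X_{n-i+1:n}}{X_{n-k:n}}\Big)=\frac{\alpha}{\alpha+1}\int_1^\infty\frac{d}{d\gamma}\,\ell_{\gamma,J}^{1+\alpha}(x)\,dx .\qquad(\mathrm L)$$ Then there exist estimators $\widehat\gamma_{k,\alpha,J}$ (for each $n$, a measurable function of $X_1,\dots,X_n$) such that the probability that $\widehat\gamma_{k,\alpha,J}$ is a positive solution of (L), with all derivatives and the integral in (L) existing, tends to $1$ as $n\to\infty$, and such that $\widehat\gamma_{k,\alpha,J}\to\gamma_0$ in probability as $n\to\infty$. -/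

import Mathlib

open MeasureTheory ProbabilityTheory Filter Topology

namespace WMDPD

/-- The tail `1 - F` of the distribution of a real random variable with cdf `F`. -/
noncomputable def tail {Ω : Type*} [MeasurableSpace Ω] (μ : Measure Ω) (X : Ω → ℝ) (u : ℝ) : ℝ :=
  1 - cdf (μ.map X) u

/-- Regular variation at infinity with index `ρ`. (When this holds, `f u ≠ 0` for all large `u`,
since the limit at `x = 1` is nonzero.) -/
def RegularlyVarying (f : ℝ → ℝ) (ρ : ℝ) : Prop :=
  ∀ x : ℝ, 0 < x → Tendsto (fun u : ℝ => f (u * x) / f u) atTop (𝓝 (x ^ ρ))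

/-- The function `s ↦ (J'(s) / J(s)) log s` attached to a weight `J`. -/
noncomputable def logSlope (J : ℝ → ℝ) (s : ℝ) : ℝ :=
  deriv J s / J s * Real.log s

/-- `g` and its derivatives up to order three exist and are bounded on `(0, 1)`. -/
structure BoundedUpToThree (g : ℝ → ℝ) : Prop where
  differentiable : ∀ m : ℕ, m < 3 → DifferentiableOn ℝ (iteratedDeriv m g) (Set.Ioo 0 1)
  bounded : ∀ m : ℕ, m ≤ 3 → ∃ C : ℝ, ∀ s ∈ Set.Ioo (0 : ℝ) 1, |iteratedDeriv m g s| ≤ C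

/-- The regularity conditions on the weight function. Only the values of `J` on `(0, 1)` are
restricted. -/
structure AdmissibleWeight (J : ℝ → ℝ) : Prop where
  continuousOn : ContinuousOn J (Set.Ioo 0 1)
  antitoneOn : AntitoneOn J (Set.Ioo 0 1)
  nonneg : ∀ s ∈ Set.Ioo (0 : ℝ) 1, 0 ≤ J s
  integral_eq_one : ∫ s in Set.Ioo (0 : ℝ) 1, J s = 1
  smooth : BoundedUpToThree J
  /-- The quotient `J' / J` makes sense on `(0, 1)`. -/
  ne_zero : ∀ s ∈ Set.Ioo (0 : ℝ) 1, J s ≠ 0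
  smooth_logSlope : BoundedUpToThree (logSlope J)

/-- The standard Pareto density `γ⁻¹ x^(-1 - 1/γ)` on `x > 1`. -/
noncomputable def paretoDensity (γ x : ℝ) : ℝ :=
  γ⁻¹ * x ^ (-1 - 1 / γ)

/-- The weighted Pareto density `J(x^(-1/γ)) ℓ_γ(x)`. -/
noncomputable def weightedDensity (J : ℝ → ℝ) (γ x : ℝ) : ℝ :=
  J (x ^ (-1 / γ)) * paretoDensity γ x

/-- The `i`-th smallest (counted from `1`) of the numbers `x 0, …, x (n - 1)`;
the value `0` for `i` outside `{1, …, n}` is a dummy. -/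
noncomputable def orderStat {n : ℕ} (x : Fin n → ℝ) (i : ℕ) : ℝ :=
  if h : 1 ≤ i ∧ i ≤ n then x (Tuple.sort x ⟨i - 1, by omega⟩) else 0

/-- The relative excess `X_{n-i+1:n} / X_{n-k:n}` of the sample `x`. -/
noncomputable def relExcess {n : ℕ} (x : Fin n → ℝ) (k i : ℕ) : ℝ :=
  orderStat x (n + 1 - i) / orderStat x (n - k)

/-- `γ > 0` is a root of the weighted MDPD estimating equation for the sample `x`, the number `k`
of upper order statistics, the tuning parameter `α` and the weight `J`. All derivatives and the
integral in the equation are required to exist. -/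
structure IsRoot (J : ℝ → ℝ) (α : ℝ) (k : ℕ) {n : ℕ} (x : Fin n → ℝ) (γ : ℝ) : Prop where
  pos : 0 < γ
  differentiable_left : ∀ i ∈ Finset.Icc 1 k,
    DifferentiableAt ℝ (fun g : ℝ => weightedDensity J g (relExcess x k i) ^ α) γ
  differentiable_right : ∀ y : ℝ, 1 < y →
    DifferentiableAt ℝ (fun g : ℝ => weightedDensity J g y ^ (1 + α)) γ
  integrable_right : IntegrableOn
    (fun y : ℝ => deriv (fun g : ℝ => weightedDensity J g y ^ (1 + α)) γ) (Set.Ioi 1)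
  equation :
    1 / (k : ℝ) * ∑ i ∈ Finset.Icc 1 k, J ((i : ℝ) / ((k : ℝ) + 1)) *
        deriv (fun g : ℝ => weightedDensity J g (relExcess x k i) ^ α) γ
      = α / (α + 1) *
        ∫ y in Set.Ioi (1 : ℝ), deriv (fun g : ℝ => weightedDensity J g y ^ (1 + α)) γ

end WMDPD

namespace WMDPD

/-! Equation (L) says that the `criterion` (the weighted empirical mean of the α-th power of the
density, minus α/(α+1) times the integral of its (1+α)-th power) has zero derivative in γ. Its limit
in probability at each fixed γ has a strict maximum at γ₀ (`population_criterion_lt`), by a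
pointwise Bernoulli inequality. Hence, with probability tending to one, the sample criterion at γ₀ -
e and γ₀ + e is below its value at γ₀. A maximizer over [γ₀ - e, γ₀ + e] is then interior and solves
(L). Only three parameter values are compared, so no uniform convergence is needed. A diagonal
choice lets e shrink with n, and taking the least maximizer gives measurability.

The limit of the criterion (`convergesInProb_average`) comes from exceedance counts. Chebyshev's
inequality and regular variation show that the order statistic of upper rank about s k, divided by a
scale b n, tends to s ^ (-γ₀); in the relative excesses the scale cancels. The average over ranks is
an integral over s in (0, 1) of a step function, so bounded convergence in s and ω gives L¹
convergence, and s = y ^ (-1/γ₀) turns the limit into an integral against the weighted Pareto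
density. -/

/-! ### Order statistics through exceedance counts -/

theorem lt_monotone_iff_le_card {n : ℕ} {f : Fin n → ℝ} (hf : Monotone f) (c : ℝ) (m : Fin n) :
    c < f m ↔ n - m ≤ (Finset.univ.filter fun j => c < f j).card := by
  constructor
  · intro h
    have hsub : Finset.Ici m ⊆ Finset.univ.filter fun j => c < f j := by
      intro j hj
      simpa using h.trans_le (hf (Finset.mem_Ici.mp hj))
    simpa using Finset.card_le_card hsub
  · intro h
    by_contra! hc
    -- If `f m ≤ c`, all exceedances lie strictly above `m`, where only n - m - 1 indices remain.
    have hsub : (Finset.univ.filter fun j => c < f j) ⊆ Finset.Ioi m := by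
      intro j hj
      rw [Finset.mem_Ioi]
      by_contra! hj'
      have := hf hj'
      simp at hj
      linarith
    have := Finset.card_le_card hsub
    simp at this
    omega

/-- The `i`-th largest value exceeds `c` exactly when at least `i` values exceed `c`. -/
theorem lt_orderStat_iff {n : ℕ} (x : Fin n → ℝ) (c : ℝ) {i : ℕ} (h1 : 1 ≤ i) (hn : i ≤ n) :
    c < orderStat x (n + 1 - i) ↔ i ≤ (Finset.univ.filter fun j => c < x j).card := by
  have hi : 1 ≤ n + 1 - i ∧ n + 1 - i ≤ n := by omega
  rw [orderStat, dif_pos hi]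
  have hc : (Finset.univ.filter fun j => c < x j).card
      = (Finset.univ.filter fun j => c < (x ∘ Tuple.sort x) j).card := by
    symm
    refine Finset.card_bij (fun j _ => Tuple.sort x j) (by simp) (by simp) ?_
    intro b hb
    exact ⟨(Tuple.sort x).symm b, by simpa using hb, by simp⟩
  have := lt_monotone_iff_le_card (Tuple.monotone_sort x) c ⟨n + 1 - i - 1, by omega⟩
  rw [hc]
  simp only [Function.comp_apply] at this ⊢
  rw [this]
  have : n - (n + 1 - i - 1) = i := by omega
  rw [this]

theorem orderStat_mono {n : ℕ} (x : Fin n → ℝ) {i j : ℕ} (hi : 1 ≤ i) (hij : i ≤ j) (hj : j ≤ n) :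
    orderStat x i ≤ orderStat x j := by
  rw [orderStat, orderStat, dif_pos ⟨hi, hij.trans hj⟩, dif_pos ⟨hi.trans hij, hj⟩]
  exact Tuple.monotone_sort x (by simp; omega)

theorem measurable_card_lt {n : ℕ} (c : ℝ) :
    Measurable fun x : Fin n → ℝ => (Finset.univ.filter fun j => c < x j).card := by
  simp_rw [Finset.card_filter]
  refine Finset.measurable_sum _ fun j _ => Measurable.ite ?_ measurable_const measurable_const
  exact measurableSet_lt measurable_const (measurable_pi_apply j)

/-- The sorting permutation need not be handled as a function of the sample: superlevel sets are
conditions on exceedance counts, which are sums of indicators. -/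
theorem measurable_orderStat (n i : ℕ) : Measurable fun x : Fin n → ℝ => orderStat x i := by
  by_cases h : 1 ≤ i ∧ i ≤ n
  · refine measurable_of_Ioi fun c => ?_
    have : (fun x : Fin n → ℝ => orderStat x i) ⁻¹' Set.Ioi c
        = {x | n + 1 - i ≤ (Finset.univ.filter fun j => c < x j).card} := by
      ext x
      have := lt_orderStat_iff x c (i := n + 1 - i) (by omega) (by omega)
      rw [show n + 1 - (n + 1 - i) = i by omega] at this
      simpa using this
    rw [this]
    exact measurableSet_le measurable_const (measurable_card_lt c)
  · simp only [orderStat, dif_neg h]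
    exact measurable_const

theorem measurable_relExcess (n k i : ℕ) : Measurable fun x : Fin n → ℝ => relExcess x k i :=
  (measurable_orderStat n _).div (measurable_orderStat n _)

theorem one_le_relExcess {n : ℕ} (x : Fin n → ℝ) {k i : ℕ} (hkn : k < n) (h1 : 1 ≤ i) (hi : i ≤ k)
    (hx : 0 < orderStat x (n - k)) : 1 ≤ relExcess x k i := by
  rw [relExcess, one_le_div hx]
  exact orderStat_mono x (by omega) (by omega) (by omega)

/-! ### Tails, regular variation and asymptotic quantiles -/

section Tail

variable {Ω : Type*} [MeasurableSpace Ω] {μ : Measure Ω}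

theorem antitone_tail (X : Ω → ℝ) : Antitone (tail μ X) := fun _ _ h =>
  sub_le_sub_left (monotone_cdf _ h) _

theorem tail_nonneg (X : Ω → ℝ) (u : ℝ) : 0 ≤ tail μ X u := sub_nonneg.mpr (cdf_le_one _ _)

theorem tendsto_tail_atTop (X : Ω → ℝ) : Tendsto (tail μ X) atTop (𝓝 0) := by
  have h := (tendsto_cdf_atTop (μ.map X)).const_sub 1
  rwa [sub_self] at h

theorem measureReal_lt_eq_tail [IsProbabilityMeasure μ] {X : Ω → ℝ} (hX : Measurable X) (c : ℝ) :
    μ.real {ω | c < X ω} = tail μ X c := by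
  have : IsProbabilityMeasure (μ.map X) := Measure.isProbabilityMeasure_map hX.aemeasurable
  rw [tail, cdf_eq_real, ← probReal_compl_eq_one_sub measurableSet_Iic,
    map_measureReal_apply hX measurableSet_Iic.compl]
  congr 1
  ext ω
  simp

theorem tail_eq_of_identDistrib {X : ℕ → Ω → ℝ}
     (hX_ident : ∀ i, IdentDistrib (X i) (X 0) μ μ) (i : ℕ) :
    tail μ (X i) = tail μ (X 0) := by
  funext u
  rw [tail, tail, (hX_ident i).map_eq]

end Tail

/-- A zero of `G` would give the quotient 0 / 0 = 0, while the limit at x = 1 is 1; so `G` is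
nonzero far out, and monotonicity carries positivity back. -/
theorem RegularlyVarying.pos {G : ℝ → ℝ} {ρ : ℝ} (hG : RegularlyVarying G ρ) (hanti : Antitone G)
    (h0 : ∀ u, 0 ≤ G u) (u : ℝ) : 0 < G u := by
  have h := hG 1 one_pos
  simp only [mul_one, Real.one_rpow] at h
  have h2 : ∀ᶠ v in atTop, G v / G v ≠ 0 := h.eventually_ne one_ne_zero
  obtain ⟨v, hv, huv⟩ := (h2.and (eventually_ge_atTop u)).exists
  have : G v ≠ 0 := by
    intro h
    simp [h] at hv
  exact ((h0 v).lt_of_ne' this).trans_le (hanti huv)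

/-- Asymptotic quantiles of a regularly varying tail, chosen among the natural numbers. -/
theorem RegularlyVarying.exists_quantile {G : ℝ → ℝ} {ρ : ℝ} (hG : RegularlyVarying G ρ)
    (hanti : Antitone G) (h0 : ∀ u, 0 ≤ G u) (hlim : Tendsto G atTop (𝓝 0))
    {t : ℕ → ℝ} (ht : Tendsto t atTop (𝓝 0)) (htpos : ∀ᶠ n in atTop, 0 < t n) :
    ∃ b : ℕ → ℝ, Tendsto b atTop atTop ∧ Tendsto (fun n => G (b n) / t n) atTop (𝓝 1) := by
  classical
  have hpos := hG.pos hanti h0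
  have hex : ∀ n, 0 < t n → ∃ m : ℕ, G m ≤ t n := fun n hn =>
    (((hlim.comp tendsto_natCast_atTop_atTop).eventually_le_const hn)).exists
  -- The least natural number at which `G` is at most `t n`; the default 0 matters only while `t n`
  -- is not positive.
  let m : ℕ → ℕ := fun n => if hn : 0 < t n then Nat.find (hex n hn) else 0
  have hm1 : ∀ n, 0 < t n → G (m n) ≤ t n := by
    intro n hn
    simp only [m, dif_pos hn]
    exact Nat.find_spec (hex n hn)
  have hm2 : ∀ n, 0 < t n → ∀ j : ℕ, j < m n → t n < G j := by
    intro n hn j hj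
    simp only [m, dif_pos hn] at hj
    exact not_le.mp (Nat.find_min (hex n hn) hj)
  have hmtop : Tendsto (fun n => (m n : ℝ)) atTop atTop := by
    refine tendsto_natCast_atTop_atTop.comp (tendsto_atTop.mpr fun M => ?_)
    filter_upwards [htpos, ht.eventually_lt_const (hpos M)] with n hn hM
    by_contra! hlt
    have h1 := hm1 n hn
    have h2 : G M ≤ G (m n) := hanti (by exact_mod_cast hlt.le)
    linarith
  refine ⟨fun n => m n, hmtop, ?_⟩
  refine tendsto_order.mpr ⟨fun c hc => ?_, fun c hc => ?_⟩
  · -- lower bound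
    -- For e < 1 and m(1 - e) ≥ 1, minimality gives t < G(m - 1) ≤ G(m e). So G(m)/t exceeds
    -- G(m)/G(m e), whose limit (e ^ ρ)⁻¹ is above c once e is close to 1.
    have hcont : ContinuousAt (fun e : ℝ => (e ^ ρ)⁻¹) 1 := by
      refine ContinuousAt.inv₀ ?_ (by simp)
      exact Real.continuousAt_rpow_const _ _ (Or.inl one_ne_zero)
    have hcev : ∀ᶠ e in 𝓝[<] (1 : ℝ), c < (e ^ ρ)⁻¹ :=
      (hcont.tendsto.eventually_const_lt (by simpa using hc)).filter_mono nhdsWithin_le_nhds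
    obtain ⟨e, he, he1, he0⟩ := (hcev.and ((eventually_mem_nhdsWithin).and
      ((eventually_gt_nhds (zero_lt_one (α := ℝ))).filter_mono nhdsWithin_le_nhds))).exists
    have he1 : e < 1 := he1
    have hlim' : Tendsto (fun n => (G (m n * e) / G (m n))⁻¹) atTop (𝓝 (e ^ ρ)⁻¹) :=
      ((hG e he0).comp hmtop).inv₀ (Real.rpow_pos_of_pos he0 _).ne'
    filter_upwards [hlim'.eventually_const_lt he, htpos,
      hmtop.eventually_ge_atTop (1 / (1 - e))] with n hn hn0 hnm
    have hm0 : (1 : ℝ) ≤ m n * (1 - e) := by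
      rwa [div_le_iff₀ (by linarith)] at hnm
    have hmpos : 0 < m n := by
      rcases Nat.eq_zero_or_pos (m n) with h | h
      · rw [h] at hm0; norm_num at hm0
      · exact h
    have h1 : t n < G (m n * e) := by
      refine (hm2 n hn0 (m n - 1) (by omega)).trans_le (hanti ?_)
      push_cast [Nat.cast_sub hmpos]
      nlinarith
    refine hn.trans ?_
    rw [inv_div]
    exact div_lt_div_of_pos_left (hpos _) hn0 h1
  · filter_upwards [htpos] with n hn
    exact ((div_le_one hn).mpr (hm1 n hn)).trans_lt hc

/-! ### Convergence in probability to a constant -/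

section ConvergesInProb

variable {Ω : Type*} [MeasurableSpace Ω] {μ : Measure Ω}

/-- Convergence in probability to a constant, in terms of neighbourhoods. -/
def ConvergesInProb {β : Type*} [TopologicalSpace β] (μ : Measure Ω) (Y : ℕ → Ω → β) (b : β) :
    Prop :=
  ∀ U ∈ 𝓝 b, Tendsto (fun n => μ {ω | Y n ω ∉ U}) atTop (𝓝 0)

theorem tendsto_measure_zero_of_subset {A B : ℕ → Set Ω} (h : ∀ᶠ n in atTop, A n ⊆ B n)
    (hB : Tendsto (fun n => μ (B n)) atTop (𝓝 0)) : Tendsto (fun n => μ (A n)) atTop (𝓝 0) :=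
  tendsto_of_tendsto_of_tendsto_of_le_of_le' tendsto_const_nhds hB
    (Eventually.of_forall fun _ => zero_le) (h.mono fun _ hn => measure_mono hn)

theorem tendsto_measure_zero_union {A B : ℕ → Set Ω}
    (hA : Tendsto (fun n => μ (A n)) atTop (𝓝 0)) (hB : Tendsto (fun n => μ (B n)) atTop (𝓝 0)) :
    Tendsto (fun n => μ (A n ∪ B n)) atTop (𝓝 0) :=
  tendsto_of_tendsto_of_tendsto_of_le_of_le tendsto_const_nhds (by simpa using hA.add hB)
    (fun _ => zero_le) (fun _ => measure_union_le _ _)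

variable {β δ : Type*} [TopologicalSpace β] [TopologicalSpace δ]

theorem ConvergesInProb.comp {Y : ℕ → Ω → β} {b : β} (hY : ConvergesInProb μ Y b) {f : β → δ}
    (hf : ContinuousAt f b) : ConvergesInProb μ (fun n ω => f (Y n ω)) (f b) :=
  fun U hU => hY (f ⁻¹' U) (hf hU)

theorem ConvergesInProb.prodMk {Y : ℕ → Ω → β} {Z : ℕ → Ω → δ} {b : β} {c : δ}
    (hY : ConvergesInProb μ Y b) (hZ : ConvergesInProb μ Z c) :
    ConvergesInProb μ (fun n ω => (Y n ω, Z n ω)) (b, c) := by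
  intro U hU
  obtain ⟨V, hV, W, hW, hVW⟩ := mem_nhds_prod_iff.mp hU
  refine tendsto_measure_zero_of_subset (Eventually.of_forall fun n ω hω => ?_)
    (tendsto_measure_zero_union (hY V hV) (hZ W hW))
  by_contra! hc
  simp only [Set.mem_union, Set.mem_ofPred_eq, not_or, not_not] at hc
  exact hω (hVW ⟨hc.1, hc.2⟩)

theorem convergesInProb_of_tendsto {y : ℕ → β} {b : β} (hy : Tendsto y atTop (𝓝 b)) :
    ConvergesInProb μ (fun n (_ : Ω) => y n) b := by
  intro U hU
  refine tendsto_const_nhds.congr' ?_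
  filter_upwards [hy hU] with n hn
  have hn : y n ∈ U := hn
  simp [hn]

theorem ConvergesInProb.congr {Y Z : ℕ → Ω → β} {b : β} (hY : ConvergesInProb μ Y b)
    (h : ∀ᶠ n in atTop, ∀ ω, Y n ω = Z n ω) : ConvergesInProb μ Z b := by
  intro U hU
  refine (hY U hU).congr' ?_
  filter_upwards [h] with n hn
  simp [hn]

/-- Lower levels are needed only near `a`, which lets applications restrict to positive levels,
where regular variation applies. -/
theorem convergesInProb_of_order {Y : ℕ → Ω → ℝ} {a : ℝ}
    (h1 : ∀ᶠ c in 𝓝[<] a, Tendsto (fun n => μ {ω | Y n ω ≤ c}) atTop (𝓝 0))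
    (h2 : ∀ c, a < c → Tendsto (fun n => μ {ω | c < Y n ω}) atTop (𝓝 0)) :
    ConvergesInProb μ Y a := by
  intro U hU
  obtain ⟨l, u, ⟨hl, hu⟩, hlu⟩ := mem_nhds_iff_exists_Ioo_subset.mp hU
  obtain ⟨c, hc, hlc⟩ := (h1.and (Ioo_mem_nhdsLT hl)).exists
  obtain ⟨v, hv, hvu⟩ := exists_between hu
  refine tendsto_measure_zero_of_subset (Eventually.of_forall fun n ω hω => ?_)
    (tendsto_measure_zero_union hc (h2 v hv))
  by_contra! hcon
  simp only [Set.mem_union, Set.mem_ofPred_eq, not_or, not_le, not_lt] at hcon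
  exact hω (hlu ⟨hlc.1.trans hcon.1, hcon.2.trans_lt hvu⟩)

end ConvergesInProb

/-! ### Exceedance counts and intermediate order statistics -/

theorem eventually_lt_of_tendsto_div {k : ℕ → ℕ}
    (hkn : Tendsto (fun n : ℕ => (k n : ℝ) / (n : ℝ)) atTop (𝓝 0)) : ∀ᶠ n in atTop, k n < n := by
  filter_upwards [hkn.eventually_lt_const zero_lt_one, eventually_gt_atTop 0] with n h1 h2
  rw [div_lt_one (by exact_mod_cast h2)] at h1
  exact_mod_cast h1

theorem tendsto_succ_div_self {k : ℕ → ℕ} (hk : Tendsto k atTop atTop) :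
    Tendsto (fun n => (((k n + 1 : ℕ)) : ℝ) / k n) atTop (𝓝 1) := by
  have hk' : Tendsto (fun n => (k n : ℝ)) atTop atTop := tendsto_natCast_atTop_atTop.comp hk
  have h := (hk'.inv_tendsto_atTop).const_add (1 : ℝ)
  rw [add_zero] at h
  refine h.congr' ?_
  filter_upwards [hk'.eventually_gt_atTop 0] with n hn
  simp only [Pi.inv_apply]
  push_cast
  field_simp

section Counts

variable {Ω : Type*} [MeasurableSpace Ω] {μ : Measure Ω} [IsProbabilityMeasure μ]
  {X : ℕ → Ω → ℝ}

/-- Chebyshev's inequality for the number of exceedances of a level. -/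
theorem measure_card_sub_ge_le (hX_meas : ∀ i, Measurable (X i)) (hX_indep : iIndepFun X μ)
    (hX_ident : ∀ i, IdentDistrib (X i) (X 0) μ μ) (n : ℕ) (c : ℝ) {r : ℝ} (hr : 0 < r) :
    μ {ω | r ≤ |((Finset.univ.filter fun j : Fin n => c < X j ω).card : ℝ)
      - n * tail μ (X 0) c|} ≤ ENNReal.ofReal (n * tail μ (X 0) c / r ^ 2) := by
  let g : ℝ → ℝ := (Set.Ioi c).indicator fun _ => 1
  have hg : Measurable g := measurable_const.indicator measurableSet_Ioi
  let Z : ℕ → Ω → ℝ := fun j ω => g (X j ω)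
  have hZm : ∀ j, Measurable (Z j) := fun j => hg.comp (hX_meas j)
  have hZ2 : ∀ j, MemLp (Z j) 2 μ := fun j =>
    MemLp.of_bound (hZm j).aestronglyMeasurable 1 (Eventually.of_forall fun ω => by
      simp only [Z, g, Set.indicator_apply]; split_ifs <;> simp)
  have hZi : ∀ j, ∫ ω, Z j ω ∂μ = tail μ (X 0) c := by
    intro j
    have : Z j = {ω | c < X j ω}.indicator fun _ => 1 := by
      funext ω
      simp [Z, g, Set.indicator_apply]
    rw [this, integral_indicator_const _ (measurableSet_lt measurable_const (hX_meas j)),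
      measureReal_lt_eq_tail (hX_meas j), tail_eq_of_identDistrib hX_ident]
    simp
  have hZv : ∀ j, Var[Z j; μ] ≤ tail μ (X 0) c := by
    intro j
    refine (variance_le_expectation_sq (hZm j).aestronglyMeasurable).trans_eq ?_
    rw [← hZi j]
    congr 1
    funext ω
    simp only [Z, g, Set.indicator_apply, Pi.pow_apply]
    split_ifs <;> simp
  have hind : iIndepFun Z μ := hX_indep.comp (fun _ => g) fun _ => hg
  have hcard : ∀ ω, ((Finset.univ.filter fun j : Fin n => c < X j ω).card : ℝ)
      = (∑ j ∈ Finset.range n, Z j) ω := by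
    intro ω
    rw [Finset.card_filter, Finset.sum_apply, ← Fin.sum_univ_eq_sum_range (fun j => Z j ω)]
    push_cast
    exact Finset.sum_congr rfl fun j _ => by simp [Z, g, Set.indicator_apply]
  have hint : μ[∑ j ∈ Finset.range n, Z j] = n * tail μ (X 0) c := by
    simp only [Finset.sum_apply]
    rw [integral_finsetSum _ fun j _ => (hZ2 j).integrable (by norm_num)]
    simp [hZi]
  have hvar : Var[∑ j ∈ Finset.range n, Z j; μ] ≤ n * tail μ (X 0) c := by
    rw [IndepFun.variance_sum (fun j _ => hZ2 j) fun i _ j _ hij => hind.indepFun hij]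
    refine (Finset.sum_le_sum fun j _ => hZv j).trans_eq ?_
    simp
  have h := meas_ge_le_variance_div_sq (memLp_finsetSum' _ fun j _ => hZ2 j :
    MemLp (∑ j ∈ Finset.range n, Z j) 2 μ) hr
  rw [hint] at h
  simp only [hcard]
  exact h.trans (ENNReal.ofReal_le_ofReal (by gcongr))

/-- The variance of the count is at most its mean, which is O(k), so Chebyshev at a deviation
proportional to k gives probability O(1/k). Half of δ is spent on the deviation, half on the
convergence of the mean. -/
theorem convergesInProb_card (hX_meas : ∀ i, Measurable (X i)) (hX_indep : iIndepFun X μ)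
    (hX_ident : ∀ i, IdentDistrib (X i) (X 0) μ μ) {k : ℕ → ℕ} (hk : Tendsto k atTop atTop)
    {c : ℕ → ℝ} {p : ℝ}
    (hc : Tendsto (fun n : ℕ => n * tail μ (X 0) (c n) / k n) atTop (𝓝 p)) :
    ConvergesInProb μ (fun n ω =>
      ((Finset.univ.filter fun j : Fin n => c n < X j ω).card : ℝ) / k n) p := by
  intro U hU
  obtain ⟨δ, hδ, hδU⟩ := Metric.mem_nhds_iff.mp hU
  have hk' : Tendsto (fun n => (k n : ℝ)) atTop atTop := tendsto_natCast_atTop_atTop.comp hk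
  have hbound : Tendsto (fun n : ℕ => ENNReal.ofReal
      (n * tail μ (X 0) (c n) / (δ / 2 * k n) ^ 2)) atTop (𝓝 0) := by
    have h1 : Tendsto (fun n : ℕ => (n * tail μ (X 0) (c n) / k n) * ((δ / 2) ^ 2)⁻¹
        * (k n : ℝ)⁻¹) atTop (𝓝 (p * ((δ / 2) ^ 2)⁻¹ * 0)) :=
      (hc.mul_const _).mul hk'.inv_tendsto_atTop
    rw [mul_zero] at h1
    have h2 := ENNReal.tendsto_ofReal h1
    rw [ENNReal.ofReal_zero] at h2
    refine h2.congr fun n => ?_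
    congr 1
    rw [mul_pow]
    field_simp
  refine tendsto_of_tendsto_of_tendsto_of_le_of_le' tendsto_const_nhds hbound
    (Eventually.of_forall fun _ => zero_le) ?_
  filter_upwards [hk'.eventually_gt_atTop 0, Metric.tendsto_nhds.mp hc (δ / 2) (by positivity)]
    with n hkn hn
  refine le_trans (measure_mono fun ω hω => ?_)
    (measure_card_sub_ge_le hX_meas hX_indep hX_ident n (c n) (by positivity))
  have hω' : δ ≤ |((Finset.univ.filter fun j : Fin n => c n < X j ω).card : ℝ) / k n - p| := by
    by_contra! hlt
    exact hω (hδU (by rwa [Metric.mem_ball, Real.dist_eq]))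
  rw [Real.dist_eq] at hn
  have h3 : δ / 2 ≤ |((Finset.univ.filter fun j : Fin n => c n < X j ω).card : ℝ) / k n
      - n * tail μ (X 0) (c n) / k n| := by
    have := abs_sub_le (((Finset.univ.filter fun j : Fin n => c n < X j ω).card : ℝ) / k n)
      (n * tail μ (X 0) (c n) / k n) p
    linarith
  rw [← sub_div, abs_div, abs_of_pos hkn, le_div_iff₀ hkn] at h3
  exact h3

/-- An intermediate order statistic, divided by the quantile, is asymptotically constant. -/
theorem convergesInProb_orderStat (hX_meas : ∀ i, Measurable (X i)) (hX_indep : iIndepFun X μ)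
    (hX_ident : ∀ i, IdentDistrib (X i) (X 0) μ μ) {k : ℕ → ℕ} (hk : Tendsto k atTop atTop)
    {γ₀ : ℝ} (hγ₀ : 0 < γ₀) {b : ℕ → ℝ} (hb : Tendsto b atTop atTop)
    (hcount : ∀ x : ℝ, 0 < x → Tendsto (fun n : ℕ => n * tail μ (X 0) (b n * x) / k n) atTop
      (𝓝 (x ^ (-1 / γ₀))))
    {i : ℕ → ℕ} (hi : ∀ᶠ n in atTop, 1 ≤ i n ∧ i n ≤ n) {s : ℝ} (hs : 0 < s)
    (his : Tendsto (fun n => (i n : ℝ) / k n) atTop (𝓝 s)) :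
    ConvergesInProb μ (fun n ω => orderStat (fun j : Fin n => X j ω) (n + 1 - i n) / b n)
      (s ^ (-γ₀)) := by
  have hinv : (s ^ (-γ₀)) ^ (-1 / γ₀) = s := by
    rw [← Real.rpow_mul hs.le]
    simp [hγ₀.ne', neg_div]
  have hneg : -1 / γ₀ < 0 := div_neg_of_neg_of_pos (by norm_num) hγ₀
  have hspos : 0 < s ^ (-γ₀) := Real.rpow_pos_of_pos hs _
  have hk' : Tendsto (fun n => (k n : ℝ)) atTop atTop := tendsto_natCast_atTop_atTop.comp hk
  refine convergesInProb_of_order ?_ ?_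
  · filter_upwards [Ioo_mem_nhdsLT hspos] with c hc
    have hlt : s < c ^ (-1 / γ₀) := by
      conv_lhs => rw [← hinv]
      exact Real.rpow_lt_rpow_of_neg hc.1 hc.2 hneg
    -- An order statistic at most c b n means fewer than `i n` exceedances of that level, so the
    -- count over k is at most v, below its limit. The gap between s and v absorbs the error in i n
    -- / k n.
    obtain ⟨v, hv1, hv2⟩ := exists_between hlt
    refine tendsto_measure_zero_of_subset ?_
      (convergesInProb_card hX_meas hX_indep hX_ident hk (hcount c hc.1) _ (Ioi_mem_nhds hv2))
    filter_upwards [hi, hb.eventually_gt_atTop 0, hk'.eventually_gt_atTop 0,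
      his.eventually_lt_const hv1] with n hin hbn hkn hisn ω hω
    simp only [Set.mem_ofPred_eq, Set.mem_Ioi, not_lt] at hω ⊢
    rw [div_le_iff₀ hbn, mul_comm, ← not_lt, lt_orderStat_iff _ _ hin.1 hin.2, not_le] at hω
    refine le_trans ?_ hisn.le
    gcongr
  · intro c hc
    have hc0 : 0 < c := hspos.trans hc
    have hlt : c ^ (-1 / γ₀) < s := by
      conv_rhs => rw [← hinv]
      exact Real.rpow_lt_rpow_of_neg hspos hc hneg
    obtain ⟨v, hv1, hv2⟩ := exists_between hlt
    refine tendsto_measure_zero_of_subset ?_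
      (convergesInProb_card hX_meas hX_indep hX_ident hk (hcount c hc0) _ (Iio_mem_nhds hv1))
    filter_upwards [hi, hb.eventually_gt_atTop 0, hk'.eventually_gt_atTop 0,
      his.eventually_const_lt hv2] with n hin hbn hkn hisn ω hω
    simp only [Set.mem_ofPred_eq, Set.mem_Iio, not_lt] at hω ⊢
    rw [lt_div_iff₀ hbn, mul_comm, lt_orderStat_iff _ _ hin.1 hin.2] at hω
    refine hisn.le.trans ?_
    gcongr

/-- For intermediate `k`, the sample has an asymptotic scale `b n` at which the order statistics
of rank proportional to `k n` converge to Pareto quantiles. -/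
theorem exists_scale (hX_meas : ∀ i, Measurable (X i)) (hX_indep : iIndepFun X μ)
    (hX_ident : ∀ i, IdentDistrib (X i) (X 0) μ μ) {γ₀ : ℝ} (hγ₀ : 0 < γ₀)
    (hF : RegularlyVarying (tail μ (X 0)) (-1 / γ₀)) {k : ℕ → ℕ} (hk : Tendsto k atTop atTop)
    (hkn : Tendsto (fun n : ℕ => (k n : ℝ) / (n : ℝ)) atTop (𝓝 0)) :
    ∃ b : ℕ → ℝ, (∀ᶠ n in atTop, 0 < b n) ∧ ∀ (i : ℕ → ℕ) (s : ℝ), 0 < s →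
      (∀ᶠ n in atTop, 1 ≤ i n ∧ i n ≤ n) → Tendsto (fun n => (i n : ℝ) / k n) atTop (𝓝 s) →
      ConvergesInProb μ (fun n ω => orderStat (fun j : Fin n => X j ω) (n + 1 - i n) / b n)
        (s ^ (-γ₀)) := by
  have hpos : ∀ᶠ n : ℕ in atTop, 0 < (k n : ℝ) / n := by
    filter_upwards [hk.eventually_gt_atTop 0, eventually_gt_atTop 0] with n h1 h2
    positivity
  obtain ⟨b, hb, hbt⟩ := hF.exists_quantile (antitone_tail _) (tail_nonneg _)
    (tendsto_tail_atTop _) hkn hpos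
  have hGpos := hF.pos (antitone_tail _) (tail_nonneg _)
  refine ⟨b, hb.eventually_gt_atTop 0, fun i s hs hi his =>
    convergesInProb_orderStat hX_meas hX_indep hX_ident hk hγ₀ hb ?_ hi hs his⟩
  intro x hx
  -- Split n G(b x)/k as G(b x)/G(b), handled by regular variation, times G(b)/(k/n), which tends to
  -- 1.
  have h := ((hF x hx).comp hb).mul hbt
  rw [mul_one] at h
  refine h.congr fun n => ?_
  have := (hGpos (b n)).ne'
  simp only [Function.comp]
  field_simp

end Counts

/-! ### Weighted averages over the relative excesses -/

/-- A Riemann-type average as the integral of a step function. -/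
theorem integral_comp_ceil_mul (a : ℕ → ℝ) {k : ℕ} (hk : 0 < k) :
    IntegrableOn (fun s : ℝ => a ⌈s * k⌉₊) (Set.Ioo 0 1) ∧
    ∫ s in Set.Ioo (0 : ℝ) 1, a ⌈s * k⌉₊ = 1 / (k : ℝ) * ∑ i ∈ Finset.Icc 1 k, a i := by
  have hk' : (0 : ℝ) < k := by exact_mod_cast hk
  let p : ℕ → ℝ := fun j => j / k
  have hp : ∀ j : ℕ, p j ≤ p (j + 1) := fun j => by
    simp only [p]
    gcongr
    simp
  have hstep : ∀ j : ℕ, Set.EqOn (fun _ => a (j + 1)) (fun s : ℝ => a ⌈s * k⌉₊)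
      (Set.uIoc (p j) (p (j + 1))) := by
    intro j s hs
    rw [Set.uIoc_of_le (hp j)] at hs
    have h1 := hs.1
    have h2 := hs.2
    simp only [p] at h1 h2
    rw [div_lt_iff₀ hk'] at h1
    rw [le_div_iff₀ hk'] at h2
    have : ⌈s * k⌉₊ = j + 1 := by
      rw [Nat.ceil_eq_iff (by omega)]
      exact ⟨by simpa using h1, h2⟩
    simp only [this]
  have hint : ∀ j < k, IntervalIntegrable (fun s : ℝ => a ⌈s * k⌉₊) volume (p j) (p (j + 1)) :=
    fun j _ => (intervalIntegrable_const (c := a (j + 1))).congr (hstep j)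
  have hp0 : p 0 = 0 := by simp [p]
  have hpk : p k = 1 := by simp [p, hk'.ne']
  have hall := IntervalIntegrable.trans_iterate hint
  rw [hp0, hpk, intervalIntegrable_iff_integrableOn_Ioo_of_le zero_le_one] at hall
  refine ⟨hall, ?_⟩
  have hsum := intervalIntegral.sum_integral_adjacent_intervals hint
  rw [hp0, hpk, intervalIntegral.integral_of_le zero_le_one, integral_Ioc_eq_integral_Ioo] at hsum
  rw [← hsum, Finset.mul_sum, ← Finset.Ico_add_one_right_eq_Icc, Finset.sum_Ico_eq_sum_range,
    Nat.add_sub_cancel]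
  refine Finset.sum_congr rfl fun j _ => ?_
  rw [intervalIntegral.integral_congr_ae (g := fun _ => a (j + 1))
    (Eventually.of_forall fun s hs => (hstep j hs).symm)]
  simp only [intervalIntegral.integral_const, p, smul_eq_mul, add_comm 1 j]
  push_cast
  ring

section Averages

variable {Ω : Type*} [MeasurableSpace Ω] {μ : Measure Ω}

/-- Bounded convergence for convergence in probability. -/
theorem ConvergesInProb.tendsto_lintegral [IsProbabilityMeasure μ] {Y : ℕ → Ω → ℝ} {b : ℝ}
    (hY : ConvergesInProb μ Y b)
    (hm : ∀ n, Measurable (Y n)) {M : ℝ} (hM : ∀ n ω, |Y n ω - b| ≤ M) :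
    Tendsto (fun n => ∫⁻ ω, ENNReal.ofReal |Y n ω - b| ∂μ) atTop (𝓝 0) := by
  rw [ENNReal.tendsto_nhds_zero]
  intro ε hε
  obtain ⟨e, he0, heε⟩ := ENNReal.lt_iff_exists_nnreal_btwn.mp (ENNReal.half_pos hε.ne')
  have he0 : 0 < e := by simpa using he0
  have hA := hY (Metric.ball b e) (Metric.ball_mem_nhds b (by exact_mod_cast he0))
  have hA' := ENNReal.Tendsto.const_mul hA (a := ENNReal.ofReal M) (Or.inr ENNReal.ofReal_ne_top)
  rw [mul_zero] at hA'
  filter_upwards [hA'.eventually_le_const (ENNReal.half_pos hε.ne')] with n hn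
  have hmeas : MeasurableSet {ω | Y n ω ∉ Metric.ball b e} :=
    ((hm n) Metric.isOpen_ball.measurableSet).compl
  calc ∫⁻ ω, ENNReal.ofReal |Y n ω - b| ∂μ
      ≤ ∫⁻ ω, ((e : ENNReal) + {ω | Y n ω ∉ Metric.ball b e}.indicator
          (fun _ => ENNReal.ofReal M) ω) ∂μ := by
        refine lintegral_mono fun ω => ?_
        by_cases hω : Y n ω ∈ Metric.ball b e
        · rw [Metric.mem_ball, Real.dist_eq] at hω
          refine le_trans ?_ le_self_add
          rw [← ENNReal.ofReal_coe_nnreal]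
          exact ENNReal.ofReal_le_ofReal hω.le
        · rw [Set.indicator_of_mem (by exact hω)]
          exact (ENNReal.ofReal_le_ofReal (hM n ω)).trans le_add_self
    _ = e + ENNReal.ofReal M * μ {ω | Y n ω ∉ Metric.ball b e} := by
        rw [lintegral_add_left measurable_const, lintegral_indicator_const hmeas]
        simp
    _ ≤ ε / 2 + ε / 2 := by gcongr
    _ = ε := ENNReal.add_halves ε

/-- Markov's inequality; the lower integral spares any integrability argument. -/
theorem convergesInProb_of_tendsto_lintegral {Y : ℕ → Ω → ℝ} {b : ℝ} (hm : ∀ n, Measurable (Y n))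
    (h : Tendsto (fun n => ∫⁻ ω, ENNReal.ofReal |Y n ω - b| ∂μ) atTop (𝓝 0)) :
    ConvergesInProb μ Y b := by
  intro U hU
  obtain ⟨δ, hδ, hδU⟩ := Metric.mem_nhds_iff.mp hU
  have hδ' : ENNReal.ofReal δ ≠ 0 := by simpa using hδ
  have h' := ENNReal.Tendsto.div_const h (b := ENNReal.ofReal δ) (Or.inr hδ')
  rw [ENNReal.zero_div] at h'
  refine tendsto_of_tendsto_of_tendsto_of_le_of_le tendsto_const_nhds h' (fun _ => zero_le)
    fun n => ?_
  have hmn : Measurable fun ω => ENNReal.ofReal |Y n ω - b| :=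
    (((hm n).sub_const b).abs).ennreal_ofReal
  refine le_trans (measure_mono fun ω hω => ?_)
    (meas_ge_le_lintegral_div hmn.aemeasurable hδ' ENNReal.ofReal_ne_top)
  refine ENNReal.ofReal_le_ofReal ?_
  by_contra! hlt
  exact hω (hδU (by rwa [Metric.mem_ball, Real.dist_eq]))

/-- Weighted averages of a bounded function over the relative excesses converge in probability. -/
theorem convergesInProb_average [IsProbabilityMeasure μ] {X : ℕ → Ω → ℝ}
    (hX_meas : ∀ i, Measurable (X i))
    (hX_indep : iIndepFun X μ)
    (hX_ident : ∀ i, IdentDistrib (X i) (X 0) μ μ) {γ₀ : ℝ} (hγ₀ : 0 < γ₀)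
    (hF : RegularlyVarying (tail μ (X 0)) (-1 / γ₀)) {k : ℕ → ℕ} (hk : Tendsto k atTop atTop)
    (hkn : Tendsto (fun n : ℕ => (k n : ℝ) / (n : ℝ)) atTop (𝓝 0))
    {J h : ℝ → ℝ} (hJ : ContinuousOn J (Set.Ioo 0 1)) {C : ℝ}
    (hJC : ∀ s ∈ Set.Ioo (0 : ℝ) 1, |J s| ≤ C)
    (hh : Measurable h) (hhc : ∀ y, 1 < y → ContinuousAt h y) {B : ℝ} (hB : ∀ y, |h y| ≤ B) :
    ConvergesInProb μ (fun n ω => 1 / (k n : ℝ) * ∑ i ∈ Finset.Icc 1 (k n),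
        J ((i : ℝ) / ((k n : ℝ) + 1)) * h (relExcess (fun j : Fin n => X j ω) (k n) i))
      (∫ s in Set.Ioo (0 : ℝ) 1, J s * h (s ^ (-γ₀))) := by
  obtain ⟨b, hbpos, hb⟩ := exists_scale hX_meas hX_indep hX_ident hγ₀ hF hk hkn
  have hk' : Tendsto (fun n => (k n : ℝ)) atTop atTop := tendsto_natCast_atTop_atTop.comp hk
  have hkn' := eventually_lt_of_tendsto_div hkn
  have hC0 : 0 ≤ C := (abs_nonneg _).trans (hJC (1 / 2) (by norm_num))
  let a : ℕ → ℕ → Ω → ℝ := fun n i ω => J ((i : ℝ) / ((k n : ℝ) + 1)) *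
    h (relExcess (fun j : Fin n => X j ω) (k n) i)
  have ham : ∀ n i, Measurable (a n i) := fun n i =>
    (hh.comp ((measurable_relExcess n (k n) i).comp
      (measurable_pi_lambda _ fun j => hX_meas j))).const_mul _
  let g : ℝ → ℝ := fun s => J s * h (s ^ (-γ₀))
  have hgc : ContinuousOn g (Set.Ioo 0 1) := by
    refine hJ.mul fun s hs => ContinuousAt.continuousWithinAt ?_
    refine ContinuousAt.comp (f := fun s : ℝ => s ^ (-γ₀))
      (hhc _ (Real.one_lt_rpow_of_pos_of_lt_one_of_neg hs.1 hs.2 (by linarith))) ?_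
    exact Real.continuousAt_rpow_const _ _ (Or.inl hs.1.ne')
  have hceil : ∀ n, ∀ s ∈ Set.Ioo (0 : ℝ) 1, 0 < k n → 1 ≤ ⌈s * k n⌉₊ ∧ ⌈s * k n⌉₊ ≤ k n := by
    intro n s hs hkn0
    have : (0 : ℝ) < k n := by exact_mod_cast hkn0
    refine ⟨Nat.one_le_iff_ne_zero.mpr (Nat.ceil_pos.mpr (mul_pos hs.1 this)).ne', ?_⟩
    exact Nat.ceil_le.mpr (by nlinarith [hs.2])
  have hJmem : ∀ n i, 1 ≤ i → i ≤ k n → (i : ℝ) / ((k n : ℝ) + 1) ∈ Set.Ioo (0 : ℝ) 1 := by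
    intro n i h1 h2
    have h1' : (1 : ℝ) ≤ i := by exact_mod_cast h1
    have h2' : (i : ℝ) ≤ k n := by exact_mod_cast h2
    exact ⟨by positivity, by rw [div_lt_one (by positivity)]; linarith⟩
  have hbd : ∀ {u v : ℝ}, |u| ≤ C → |u * h v| ≤ C * B := fun hu => by
    rw [abs_mul]
    exact mul_le_mul hu (hB _) (abs_nonneg _) hC0
  have hag : ∀ n, 0 < k n → ∀ s ∈ Set.Ioo (0 : ℝ) 1, ∀ ω,
      |a n ⌈s * k n⌉₊ ω - g s| ≤ C * B + C * B := by
    intro n hn s hs ω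
    obtain ⟨h1, h2⟩ := hceil n s hs hn
    exact (abs_sub _ _).trans (add_le_add (hbd (hJC _ (hJmem n _ h1 h2))) (hbd (hJC s hs)))
  -- pointwise convergence in the rank
  have hpt : ∀ s ∈ Set.Ioo (0 : ℝ) 1, ConvergesInProb μ (fun n => a n ⌈s * k n⌉₊) (g s) := by
    intro s hs
    have hlim : Tendsto (fun n => (⌈s * k n⌉₊ : ℝ) / k n) atTop (𝓝 s) :=
      (tendsto_nat_ceil_mul_div_atTop hs.1.le).comp hk'
    have hev : ∀ᶠ n in atTop, 1 ≤ ⌈s * k n⌉₊ ∧ ⌈s * k n⌉₊ ≤ n := by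
      filter_upwards [hkn', hk.eventually_gt_atTop 0] with n h1 h2
      obtain ⟨h3, h4⟩ := hceil n s hs h2
      omega
    have hnum := hb (fun n => ⌈s * k n⌉₊) s hs.1 hev hlim
    -- The denominator of the excess has upper rank k + 1, so its limit is the case s = 1, and b n
    -- cancels in the quotient.
    have hlim1 := tendsto_succ_div_self hk
    have hden := hb (fun n => k n + 1) 1 one_pos
      (by filter_upwards [hkn'] with n hn; omega) hlim1
    rw [Real.one_rpow] at hden
    have hJlim : Tendsto (fun n => J ((⌈s * k n⌉₊ : ℝ) / ((k n : ℝ) + 1))) atTop (𝓝 (J s)) := by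
      refine ((hJ.continuousAt (Ioo_mem_nhds hs.1 hs.2)).tendsto.comp ?_)
      have h := hlim.div hlim1 one_ne_zero
      rw [div_one] at h
      refine h.congr' ?_
      filter_upwards [hk'.eventually_gt_atTop 0] with n hn
      simp only [Pi.div_apply]
      push_cast
      field_simp
    have hgt : 1 < s ^ (-γ₀) := Real.one_lt_rpow_of_pos_of_lt_one_of_neg hs.1 hs.2 (by linarith)
    have hcont : ContinuousAt (fun q : ℝ × ℝ × ℝ => q.1 * h (q.2.1 / q.2.2))
        (J s, s ^ (-γ₀), 1) := by
      refine continuousAt_fst.mul (ContinuousAt.comp (g := h) ?_ ?_)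
      · simpa using hhc _ hgt
      · exact (continuousAt_snd.fst).div continuousAt_snd.snd one_ne_zero
    have hc := ((convergesInProb_of_tendsto (μ := μ) hJlim).prodMk (hnum.prodMk hden)).comp hcont
    simp only [div_one] at hc
    refine hc.congr ?_
    filter_upwards [hbpos] with n hn ω
    simp only [a, relExcess]
    rw [div_div_div_cancel_right₀ hn.ne', show n + 1 - (k n + 1) = n - k n by omega]
  -- joint measurability
  have hjoint : ∀ n, AEMeasurable (fun q : ℝ × Ω => ENNReal.ofReal |a n ⌈q.1 * k n⌉₊ q.2 - g q.1|)
      ((volume.restrict (Set.Ioo (0 : ℝ) 1)).prod μ) := by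
    intro n
    have h1 : Measurable fun q : ℕ × Ω => a n q.1 q.2 :=
      measurable_from_prod_countable_right fun i => ham n i
    have h2 : Measurable fun q : ℝ × Ω => a n ⌈q.1 * k n⌉₊ q.2 :=
      h1.comp ((Nat.measurable_ceil.comp (measurable_fst.mul_const _)).prodMk measurable_snd)
    have h3 : AEMeasurable (fun q : ℝ × Ω => g q.1)
        ((volume.restrict (Set.Ioo (0 : ℝ) 1)).prod μ) :=
      (hgc.aemeasurable measurableSet_Ioo).comp_fst
    exact ((h2.aemeasurable.sub h3).abs).ennreal_ofReal
  have hkpos : ∀ᶠ n in atTop, 0 < k n := hk.eventually_gt_atTop 0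
  have hdom : Tendsto (fun n => ∫⁻ s in Set.Ioo (0 : ℝ) 1, ∫⁻ ω,
      ENNReal.ofReal |a n ⌈s * k n⌉₊ ω - g s| ∂μ) atTop (𝓝 0) := by
    have h := tendsto_lintegral_filter_of_dominated_convergence'
      (μ := volume.restrict (Set.Ioo (0 : ℝ) 1)) (l := atTop)
      (F := fun n s => ∫⁻ ω, ENNReal.ofReal |a n ⌈s * k n⌉₊ ω - g s| ∂μ) (f := fun _ => 0)
      (fun _ => ENNReal.ofReal (C * B + C * B))
      (Eventually.of_forall fun n => (hjoint n).lintegral_prod_right') ?_ ?_ ?_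
    · simpa using h
    · filter_upwards [hkpos] with n hn
      filter_upwards [ae_restrict_mem measurableSet_Ioo] with s hs
      refine (lintegral_mono fun ω => ENNReal.ofReal_le_ofReal (hag n hn s hs ω)).trans ?_
      simp
    · simp
    · filter_upwards [ae_restrict_mem measurableSet_Ioo] with s hs
      -- The uniform bound holds only when `k n > 0`, so the sequence is shifted to make it hold for
      -- every index.
      obtain ⟨N, hN⟩ := eventually_atTop.mp hkpos
      rw [← tendsto_add_atTop_iff_nat N]
      refine ConvergesInProb.tendsto_lintegral (Y := fun n => a (n + N) ⌈s * k (n + N)⌉₊) ?_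
        (fun n => ham _ _) fun n ω => hag _ (hN _ (by omega)) s hs ω
      exact fun U hU => (tendsto_add_atTop_iff_nat N).mpr (hpt s hs U hU)
  refine convergesInProb_of_tendsto_lintegral
    (fun n => (Finset.measurable_sum _ fun i _ => ham n i).const_mul _) ?_
  refine tendsto_of_tendsto_of_tendsto_of_le_of_le' tendsto_const_nhds hdom
    (Eventually.of_forall fun _ => zero_le) ?_
  filter_upwards [hkpos] with n hn
  -- After Tonelli, it remains for each ω to bound the absolute value of an integral over s by the
  -- integral of the absolute value.
  rw [lintegral_lintegral_swap (hjoint n)]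
  refine lintegral_mono fun ω => ?_
  obtain ⟨hi, he⟩ := integral_comp_ceil_mul (fun i => a n i ω) hn
  have hgi : IntegrableOn g (Set.Ioo 0 1) := by
    refine Integrable.of_bound (hgc.aestronglyMeasurable measurableSet_Ioo) (C * B) ?_
    filter_upwards [ae_restrict_mem measurableSet_Ioo] with s hs
    exact hbd (hJC s hs)
  have : 1 / (k n : ℝ) * ∑ i ∈ Finset.Icc 1 (k n), J ((i : ℝ) / ((k n : ℝ) + 1)) *
      h (relExcess (fun j : Fin n => X j ω) (k n) i) - ∫ s in Set.Ioo (0 : ℝ) 1, J s * h (s ^ (-γ₀))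
      = ∫ s in Set.Ioo (0 : ℝ) 1, (a n ⌈s * k n⌉₊ ω - g s) := by
    rw [integral_sub hi hgi, he]
  rw [this]
  have h := enorm_integral_le_lintegral_enorm (μ := volume.restrict (Set.Ioo (0 : ℝ) 1))
    fun s => a n ⌈s * k n⌉₊ ω - g s
  simpa only [Real.enorm_eq_ofReal_abs] using h

end Averages

/-! ### Calculus of the weighted density in its parameter -/

namespace AdmissibleWeight

variable {J : ℝ → ℝ}

theorem pos (hJ : AdmissibleWeight J) {s : ℝ} (hs : s ∈ Set.Ioo (0 : ℝ) 1) : 0 < J s :=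
  (hJ.nonneg s hs).lt_of_ne' (hJ.ne_zero s hs)

theorem hasDerivAt (hJ : AdmissibleWeight J) {s : ℝ} (hs : s ∈ Set.Ioo (0 : ℝ) 1) :
    HasDerivAt J (deriv J s) s := by
  have h := hJ.smooth.differentiable 0 (by norm_num)
  rw [iteratedDeriv_zero] at h
  exact (h.differentiableAt (Ioo_mem_nhds hs.1 hs.2)).hasDerivAt

theorem continuousOn_deriv (hJ : AdmissibleWeight J) : ContinuousOn (deriv J) (Set.Ioo 0 1) := by
  have h := hJ.smooth.differentiable 1 (by norm_num)
  rw [iteratedDeriv_one] at h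
  exact h.continuousOn

theorem exists_bound (hJ : AdmissibleWeight J) :
    ∃ C : ℝ, 0 < C ∧ ∀ s ∈ Set.Ioo (0 : ℝ) 1, |J s| ≤ C ∧ |deriv J s| ≤ C := by
  obtain ⟨C, hC⟩ := hJ.smooth.bounded 0 (by norm_num)
  obtain ⟨D, hD⟩ := hJ.smooth.bounded 1 (by norm_num)
  rw [iteratedDeriv_zero] at hC
  rw [iteratedDeriv_one] at hD
  refine ⟨max 1 (max C D), by positivity, fun s hs => ⟨(hC s hs).trans ?_, (hD s hs).trans ?_⟩⟩
  · exact (le_max_left C D).trans (le_max_right _ _)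
  · exact (le_max_right C D).trans (le_max_right _ _)

end AdmissibleWeight

theorem rpow_neg_one_div_mem {γ y : ℝ} (hγ : 0 < γ) (hy : 1 < y) :
    y ^ (-1 / γ) ∈ Set.Ioo (0 : ℝ) 1 :=
  ⟨Real.rpow_pos_of_pos (by linarith) _,
    Real.rpow_lt_one_of_one_lt_of_neg hy (div_neg_of_neg_of_pos (by norm_num) hγ)⟩

/-- The derivative of the weighted Pareto density with respect to its parameter. -/
noncomputable def weightedDensityDeriv (J : ℝ → ℝ) (γ y : ℝ) : ℝ :=
  deriv J (y ^ (-1 / γ)) * (Real.log y * (1 / γ ^ 2) * y ^ (-1 / γ)) * paretoDensity γ y +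
    J (y ^ (-1 / γ)) * (-(γ ^ 2)⁻¹ * y ^ (-1 - 1 / γ) +
      γ⁻¹ * (Real.log y * (1 / γ ^ 2) * y ^ (-1 - 1 / γ)))

theorem paretoDensity_pos {γ y : ℝ} (hγ : 0 < γ) (hy : 0 < y) : 0 < paretoDensity γ y :=
  mul_pos (inv_pos.mpr hγ) (Real.rpow_pos_of_pos hy _)

section Calculus

variable {J : ℝ → ℝ}

theorem weightedDensity_pos (hJ : AdmissibleWeight J) {γ y : ℝ} (hγ : 0 < γ) (hy : 1 < y) :
    0 < weightedDensity J γ y :=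
  mul_pos (hJ.pos (rpow_neg_one_div_mem hγ hy)) (paretoDensity_pos hγ (by linarith))

theorem hasDerivAt_weightedDensity (hJ : AdmissibleWeight J) {γ y : ℝ} (hγ : 0 < γ) (hy : 1 < y) :
    HasDerivAt (fun g => weightedDensity J g y) (weightedDensityDeriv J γ y) γ := by
  have hy0 : 0 < y := by linarith
  have h1 : HasDerivAt (fun g : ℝ => -1 / g) (1 / γ ^ 2) γ := by
    have h := (hasDerivAt_inv hγ.ne').const_mul (-1)
    simpa [div_eq_mul_inv] using h
  have h2 : HasDerivAt (fun g : ℝ => -1 - 1 / g) (1 / γ ^ 2) γ := by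
    have h := (hasDerivAt_inv hγ.ne').const_sub (-1)
    simpa [div_eq_mul_inv] using h
  have h3 := HasDerivAt.const_rpow hy0 h1
  have h4 := HasDerivAt.const_rpow hy0 h2
  have h5 := (hJ.hasDerivAt (rpow_neg_one_div_mem hγ hy)).comp γ h3
  exact h5.mul ((hasDerivAt_inv hγ.ne').mul h4)

theorem hasDerivAt_weightedDensity_rpow (hJ : AdmissibleWeight J) {γ y : ℝ} (hγ : 0 < γ)
    (hy : 1 < y) (p : ℝ) :
    HasDerivAt (fun g => weightedDensity J g y ^ p)
      (weightedDensityDeriv J γ y * p * weightedDensity J γ y ^ (p - 1)) γ :=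
  (hasDerivAt_weightedDensity hJ hγ hy).rpow_const (Or.inl (weightedDensity_pos hJ hγ hy).ne')

/-- Ties can produce an excess equal to 1, where `J` is unrestricted. There the density is the
constant `J 1` times γ⁻¹, so differentiability survives. -/
theorem differentiableAt_weightedDensity_one_rpow {γ p : ℝ} (hγ : 0 < γ) :
    DifferentiableAt ℝ (fun g => weightedDensity J g 1 ^ p) γ := by
  simp only [weightedDensity, paretoDensity, Real.one_rpow, mul_one]
  by_cases h : J 1 = 0
  · simp [h]
  · refine DifferentiableAt.rpow_const ?_ (Or.inl ?_)
    · exact (differentiableAt_inv hγ.ne').const_mul _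
    · exact mul_ne_zero h (inv_ne_zero hγ.ne')

theorem differentiableAt_weightedDensity_rpow (hJ : AdmissibleWeight J) {γ y p : ℝ} (hγ : 0 < γ)
    (hy : 1 ≤ y) :
    DifferentiableAt ℝ (fun g => weightedDensity J g y ^ p) γ := by
  rcases hy.eq_or_lt with rfl | hy
  · exact differentiableAt_weightedDensity_one_rpow hγ
  · exact (hasDerivAt_weightedDensity_rpow hJ hγ hy p).differentiableAt

theorem continuousOn_weightedDensity (hJ : AdmissibleWeight J) {γ : ℝ} (hγ : 0 < γ) :
    ContinuousOn (weightedDensity J γ) (Set.Ioi 1) := by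
  have hr : ∀ p : ℝ, ContinuousOn (fun y : ℝ => y ^ p) (Set.Ioi 1) := fun p y hy =>
    (Real.continuousAt_rpow_const _ _ (Or.inl (by
      have : (1 : ℝ) < y := hy
      linarith))).continuousWithinAt
  exact (hJ.continuousOn.comp (hr _) fun y hy => rpow_neg_one_div_mem hγ hy).mul
    (continuousOn_const.mul (hr _))

theorem continuousOn_weightedDensity_rpow (hJ : AdmissibleWeight J) {γ : ℝ} (hγ : 0 < γ) (p : ℝ) :
    ContinuousOn (fun y => weightedDensity J γ y ^ p) (Set.Ioi 1) :=
  (continuousOn_weightedDensity hJ hγ).rpow_const fun _ hy =>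
    Or.inl (weightedDensity_pos hJ hγ hy).ne'

theorem continuousOn_weightedDensityDeriv (hJ : AdmissibleWeight J) {γ : ℝ} (hγ : 0 < γ) :
    ContinuousOn (weightedDensityDeriv J γ) (Set.Ioi 1) := by
  have hne : ∀ y ∈ Set.Ioi (1 : ℝ), y ≠ 0 := fun y hy => by
    have : (1 : ℝ) < y := hy
    linarith
  have hr : ∀ p : ℝ, ContinuousOn (fun y : ℝ => y ^ p) (Set.Ioi 1) := fun p y hy =>
    (Real.continuousAt_rpow_const _ _ (Or.inl (hne y hy))).continuousWithinAt
  have hl : ContinuousOn Real.log (Set.Ioi 1) := Real.continuousOn_log.mono hne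
  have hm : Set.MapsTo (fun y : ℝ => y ^ (-1 / γ)) (Set.Ioi 1) (Set.Ioo 0 1) :=
    fun y hy => rpow_neg_one_div_mem hγ hy
  refine ((hJ.continuousOn_deriv.comp (hr _) hm).mul ((hl.mul continuousOn_const).mul (hr _))).mul
    (continuousOn_const.mul (hr _)) |>.add ((hJ.continuousOn.comp (hr _) hm).mul
      ((continuousOn_const.mul (hr _)).add (continuousOn_const.mul
        ((hl.mul continuousOn_const).mul (hr _)))))

/-- Domination of the powers of the weighted density and of their parameter derivatives, locally
uniformly in the parameter. -/
theorem exists_bound_weightedDensity_rpow (hJ : AdmissibleWeight J) {γ α : ℝ} (hγ : 0 < γ)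
    (hα : 0 < α) :
    ∃ K : ℝ, ∀ g ∈ Set.Ioo (γ / 2) (2 * γ), ∀ y : ℝ, 1 < y →
      weightedDensity J g y ^ α ≤ K ∧
      weightedDensity J g y ^ (1 + α) ≤ K * y ^ (-1 - 1 / (2 * γ)) ∧
      |weightedDensityDeriv J g y * (1 + α) * weightedDensity J g y ^ (1 + α - 1)|
        ≤ K * y ^ (-1 - 1 / (4 * γ)) := by
  obtain ⟨C, hC0, hC⟩ := hJ.exists_bound
  -- On the parameter interval g⁻¹ < 2/γ, so A bounds the density; D collects the two terms of its
  -- parameter derivative.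
  set A : ℝ := C * (2 / γ) with hA
  have hA0 : 0 < A := by positivity
  set D : ℝ := C * (2 / γ) ^ 2 * (4 * γ) * (2 / γ) + C * ((2 / γ) ^ 2 +
    (2 / γ) * ((4 * γ) * (2 / γ) ^ 2)) with hD
  have hD0 : 0 ≤ D := by positivity
  refine ⟨max (A ^ α) (max (A * A ^ α) (D * (1 + α) * A ^ α)), fun g hg y hy => ?_⟩
  have hg0 : 0 < g := lt_trans (by positivity) hg.1
  have hy0 : 0 < y := by linarith
  have hL : 0 ≤ Real.log y := Real.log_nonneg hy.le
  have hginv : g⁻¹ ≤ 2 / γ := by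
    rw [inv_le_comm₀ hg0 (by positivity), inv_div]
    exact hg.1.le
  have hginv0 : 0 < g⁻¹ := inv_pos.mpr hg0
  have hv := rpow_neg_one_div_mem hg0 hy
  obtain ⟨hJ1, hJ2⟩ := hC _ hv
  set z : ℝ := y ^ (-1 - 1 / (2 * γ)) with hz
  have hz0 : 0 < z := Real.rpow_pos_of_pos hy0 _
  have hz1 : z ≤ 1 := Real.rpow_le_one_of_one_le_of_nonpos hy.le (by
    have : 0 < 1 / (2 * γ) := by positivity
    linarith)
  have hyg : y ^ (-1 - 1 / g) ≤ z := by
    refine Real.rpow_le_rpow_of_exponent_le hy.le ?_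
    have : 1 / (2 * γ) ≤ 1 / g := one_div_le_one_div_of_le hg0 hg.2.le
    linarith
  have hyg0 : 0 < y ^ (-1 - 1 / g) := Real.rpow_pos_of_pos hy0 _
  have hw0 := weightedDensity_pos hJ hg0 hy
  have hw : weightedDensity J g y ≤ A * z := by
    rw [weightedDensity, paretoDensity, hA, mul_assoc]
    have := le_of_abs_le hJ1
    gcongr
  have hwA : weightedDensity J g y ≤ A := hw.trans (mul_le_of_le_one_right hA0.le hz1)
  have hwα : weightedDensity J g y ^ α ≤ A ^ α := Real.rpow_le_rpow hw0.le hwA hα.le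
  have hz'0 : 0 < y ^ (-1 - 1 / (4 * γ)) := Real.rpow_pos_of_pos hy0 _
  refine ⟨hwα.trans (le_max_left _ _), ?_, ?_⟩
  · rw [Real.rpow_add hw0, Real.rpow_one]
    calc weightedDensity J g y * weightedDensity J g y ^ α ≤ A * z * A ^ α := by gcongr
      _ = A * A ^ α * z := by ring
      _ ≤ _ := by
        gcongr
        exact (le_max_left _ _).trans (le_max_right _ _)
  · set z' : ℝ := y ^ (-1 - 1 / (4 * γ)) with hz'
    have hzz' : z ≤ z' := by
      refine Real.rpow_le_rpow_of_exponent_le hy.le ?_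
      have : 1 / (4 * γ) ≤ 1 / (2 * γ) := by
        apply one_div_le_one_div_of_le <;> linarith
      linarith
    -- The logarithm is absorbed by y ^ (1/(4γ)), which uses half of the spare decay 1/(2γ) and
    -- leaves an integrable power.
    have hLz : Real.log y * z ≤ 4 * γ * z' := by
      have h := Real.log_le_rpow_div hy0.le (show 0 < 1 / (4 * γ) by positivity)
      calc Real.log y * z ≤ y ^ (1 / (4 * γ)) / (1 / (4 * γ)) * z := by gcongr
        _ = 4 * γ * (y ^ (1 / (4 * γ)) * z) := by field_simp
        _ = 4 * γ * z' := by
          rw [hz, ← Real.rpow_add hy0, hz']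
          congr 2
          field_simp
          ring
    have hq : 1 / g ^ 2 ≤ (2 / γ) ^ 2 := by
      rw [one_div, ← inv_pow]
      gcongr
    have hq' : (g ^ 2)⁻¹ ≤ (2 / γ) ^ 2 := by rwa [← one_div]
    have hderiv : |weightedDensityDeriv J g y| ≤ D * z' := by
      have hLy : Real.log y * y ^ (-1 - 1 / g) ≤ 4 * γ * z' :=
        (mul_le_mul_of_nonneg_left hyg hL).trans hLz
      have e1 : |deriv J (y ^ (-1 / g)) * (Real.log y * (1 / g ^ 2) * y ^ (-1 / g)) *
          paretoDensity g y| ≤ C * (2 / γ) ^ 2 * (4 * γ) * (2 / γ) * z' := by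
        rw [abs_mul, abs_mul, abs_of_pos (paretoDensity_pos hg0 hy0),
          abs_of_nonneg (mul_nonneg (by positivity) hv.1.le), paretoDensity]
        calc |deriv J (y ^ (-1 / g))| * (Real.log y * (1 / g ^ 2) * y ^ (-1 / g)) *
              (g⁻¹ * y ^ (-1 - 1 / g))
            ≤ C * (Real.log y * (1 / g ^ 2) * 1) * (g⁻¹ * y ^ (-1 - 1 / g)) := by
              have := hv.2.le
              gcongr
          _ = C * (1 / g ^ 2) * (Real.log y * y ^ (-1 - 1 / g)) * g⁻¹ := by ring
          _ ≤ C * (2 / γ) ^ 2 * (4 * γ * z') * (2 / γ) := by gcongr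
          _ = _ := by ring
      have e2 : |J (y ^ (-1 / g)) * (-(g ^ 2)⁻¹ * y ^ (-1 - 1 / g) +
          g⁻¹ * (Real.log y * (1 / g ^ 2) * y ^ (-1 - 1 / g)))| ≤
          C * ((2 / γ) ^ 2 + (2 / γ) * ((4 * γ) * (2 / γ) ^ 2)) * z' := by
        rw [abs_mul, mul_assoc C]
        refine mul_le_mul hJ1 ?_ (abs_nonneg _) hC0.le
        refine (abs_add_le _ _).trans ?_
        rw [neg_mul, abs_neg, abs_of_nonneg (by positivity), abs_of_nonneg (by positivity)]
        calc (g ^ 2)⁻¹ * y ^ (-1 - 1 / g) + g⁻¹ * (Real.log y * (1 / g ^ 2) * y ^ (-1 - 1 / g))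
            = (g ^ 2)⁻¹ * y ^ (-1 - 1 / g) + g⁻¹ * ((Real.log y * y ^ (-1 - 1 / g)) * (1 / g ^ 2)) := by
              ring
          _ ≤ (2 / γ) ^ 2 * z' + (2 / γ) * ((4 * γ * z') * (2 / γ) ^ 2) := by
              have := hyg.trans hzz'
              gcongr
          _ = _ := by ring
      refine (abs_add_le _ _).trans ((add_le_add e1 e2).trans_eq ?_)
      rw [hD]
      ring
    rw [add_sub_cancel_left, abs_mul, abs_mul, abs_of_pos (show 0 < 1 + α by linarith),
      abs_of_pos (Real.rpow_pos_of_pos hw0 _)]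
    calc |weightedDensityDeriv J g y| * (1 + α) * weightedDensity J g y ^ α
        ≤ D * z' * (1 + α) * A ^ α := by gcongr
      _ = D * (1 + α) * A ^ α * z' := by ring
      _ ≤ _ := by
        gcongr
        exact (le_max_right _ _).trans (le_max_right _ _)

theorem mem_Ioo_half_double {γ : ℝ} (hγ : 0 < γ) : γ ∈ Set.Ioo (γ / 2) (2 * γ) :=
  ⟨by linarith, by linarith⟩

theorem integrableOn_rpow_neg {c : ℝ} (hc : 0 < c) :
    IntegrableOn (fun y : ℝ => y ^ (-1 - 1 / c)) (Set.Ioi 1) :=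
  integrableOn_Ioi_rpow_of_lt (by
    have : 0 < 1 / c := by positivity
    linarith) one_pos

theorem integrableOn_weightedDensity_rpow (hJ : AdmissibleWeight J) {γ α : ℝ} (hγ : 0 < γ)
    (hα : 0 < α) :
    IntegrableOn (fun y => weightedDensity J γ y ^ (1 + α)) (Set.Ioi 1) := by
  obtain ⟨K, hK⟩ := exists_bound_weightedDensity_rpow hJ hγ hα
  refine Integrable.mono' ((integrableOn_rpow_neg (by positivity : 0 < 2 * γ)).const_mul K)
    ((continuousOn_weightedDensity_rpow hJ hγ _).aestronglyMeasurable measurableSet_Ioi) ?_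
  filter_upwards [ae_restrict_mem measurableSet_Ioi] with y hy
  rw [Real.norm_of_nonneg (Real.rpow_nonneg (weightedDensity_pos hJ hγ hy).le _)]
  exact (hK γ (mem_Ioo_half_double hγ) y hy).2.1

/-- Differentiation of the integral in the estimating equation under the integral sign. -/
theorem hasDerivAt_integral_weightedDensity_rpow (hJ : AdmissibleWeight J) {γ α : ℝ} (hγ : 0 < γ)
    (hα : 0 < α) :
    IntegrableOn (fun y => deriv (fun g => weightedDensity J g y ^ (1 + α)) γ) (Set.Ioi 1) ∧
    HasDerivAt (fun g => ∫ y in Set.Ioi 1, weightedDensity J g y ^ (1 + α))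
      (∫ y in Set.Ioi 1, deriv (fun g => weightedDensity J g y ^ (1 + α)) γ) γ := by
  obtain ⟨K, hK⟩ := exists_bound_weightedDensity_rpow hJ hγ hα
  have hmem := mem_Ioo_half_double hγ
  have hpos : ∀ g ∈ Set.Ioo (γ / 2) (2 * γ), 0 < g := fun g hg => lt_trans (by positivity) hg.1
  have hmeas : AEStronglyMeasurable (fun y => weightedDensityDeriv J γ y * (1 + α) *
      weightedDensity J γ y ^ (1 + α - 1)) (volume.restrict (Set.Ioi 1)) :=
    (((continuousOn_weightedDensityDeriv hJ hγ).mul continuousOn_const).mul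
      (continuousOn_weightedDensity_rpow hJ hγ _)).aestronglyMeasurable measurableSet_Ioi
  have h := hasDerivAt_integral_of_dominated_loc_of_deriv_le
    (μ := volume.restrict (Set.Ioi (1 : ℝ))) (x₀ := γ)
    (F := fun g y => weightedDensity J g y ^ (1 + α))
    (F' := fun g y => weightedDensityDeriv J g y * (1 + α) * weightedDensity J g y ^ (1 + α - 1))
    (bound := fun y => K * y ^ (-1 - 1 / (4 * γ))) (Ioo_mem_nhds hmem.1 hmem.2) ?_
    (integrableOn_weightedDensity_rpow hJ hγ hα) hmeas ?_
    ((integrableOn_rpow_neg (by positivity : 0 < 4 * γ)).const_mul K) ?_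
  · have hcongr : Set.EqOn (fun y => weightedDensityDeriv J γ y * (1 + α) *
        weightedDensity J γ y ^ (1 + α - 1))
        (fun y => deriv (fun g => weightedDensity J g y ^ (1 + α)) γ) (Set.Ioi 1) :=
      fun y hy => (hasDerivAt_weightedDensity_rpow hJ hγ hy (1 + α)).deriv.symm
    rw [← setIntegral_congr_fun measurableSet_Ioi hcongr,
      ← integrableOn_congr_fun hcongr measurableSet_Ioi]
    exact h
  · filter_upwards [Ioo_mem_nhds hmem.1 hmem.2] with g hg
    exact (continuousOn_weightedDensity_rpow hJ (hpos g hg) _).aestronglyMeasurable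
      measurableSet_Ioi
  · filter_upwards [ae_restrict_mem measurableSet_Ioi] with y hy g hg
    exact (hK g hg y hy).2.2
  · filter_upwards [ae_restrict_mem measurableSet_Ioi] with y hy g hg
    exact hasDerivAt_weightedDensity_rpow hJ (hpos g hg) hy _

end Calculus

/-! ### The population criterion and identifiability -/

/-- The pointwise inequality behind the density power divergence. -/
theorem density_power_lt {a b α : ℝ} (ha : 0 < a) (hb : 0 < b) (hα : 0 < α) (hab : a ≠ b) :
    a * b ^ α - α / (α + 1) * b ^ (1 + α) < a * a ^ α - α / (α + 1) * a ^ (1 + α) := by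
  -- Bernoulli's strict inequality at a/b - 1 with exponent 1 + α; multiplying by b ^ (1 + α) and
  -- dividing by α + 1 gives the claim.
  have h := one_add_mul_self_lt_rpow_one_add (s := a / b - 1) (p := 1 + α)
    (by have : 0 < a / b := by positivity
        linarith) (by rwa [sub_ne_zero, ne_eq, div_eq_one_iff_eq hb.ne']) (by linarith)
  rw [add_sub_cancel, Real.div_rpow ha.le hb.le, lt_div_iff₀ (by positivity),
    Real.rpow_add ha, Real.rpow_add hb, Real.rpow_one, Real.rpow_one] at h
  rw [Real.rpow_add ha, Real.rpow_add hb, Real.rpow_one, Real.rpow_one]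
  have h2 : (1 + (1 + α) * (a / b - 1)) * (b * b ^ α)
      = (1 + α) * (a * b ^ α) - α * (b * b ^ α) := by
    field_simp
    ring
  rw [h2] at h
  have h3 : a * a ^ α - α / (α + 1) * (a * a ^ α) = a * a ^ α / (α + 1) := by
    field_simp
    ring
  have h4 : a * b ^ α - α / (α + 1) * (b * b ^ α)
      = ((1 + α) * (a * b ^ α) - α * (b * b ^ α)) / (α + 1) := by
    field_simp
    ring
  rw [h3, h4]
  gcongr

theorem density_power_le {a b α : ℝ} (ha : 0 < a) (hb : 0 < b) (hα : 0 < α) :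
    a * b ^ α - α / (α + 1) * b ^ (1 + α) ≤ a * a ^ α - α / (α + 1) * a ^ (1 + α) := by
  rcases eq_or_ne a b with rfl | h
  · exact le_rfl
  · exact (density_power_lt ha hb hα h).le

section Population

variable {J : ℝ → ℝ}

/-- Heavier tails eventually dominate, whatever the weight. -/
theorem eventually_weightedDensity_lt (hJ : AdmissibleWeight J) {γ γ' : ℝ} (hγ : 0 < γ)
    (hγγ' : γ < γ') : ∀ᶠ y in atTop, weightedDensity J γ y < weightedDensity J γ' y := by
  have hγ' : 0 < γ' := hγ.trans hγγ'
  obtain ⟨C, hC0, hC⟩ := hJ.exists_bound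
  have hJ0 : 0 < J (1 / 2) := hJ.pos (by norm_num)
  have he : 0 < 1 / γ - 1 / γ' := sub_pos.mpr (one_div_lt_one_div_of_lt hγ hγγ')
  have h1 : Tendsto (fun y : ℝ => C * γ⁻¹ * y ^ (-(1 / γ - 1 / γ'))) atTop (𝓝 0) := by
    simpa using (tendsto_rpow_neg_atTop he).const_mul (C * γ⁻¹)
  have h2 : Tendsto (fun y : ℝ => y ^ (-(1 / γ'))) atTop (𝓝 0) :=
    tendsto_rpow_neg_atTop (by positivity)
  filter_upwards [h1.eventually_lt_const (show 0 < J (1 / 2) * γ'⁻¹ by positivity),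
    h2.eventually_lt_const (show (0 : ℝ) < 1 / 2 by norm_num), eventually_gt_atTop 1]
    with y hy1 hy2 hy
  have hy0 : 0 < y := by linarith
  have hv := rpow_neg_one_div_mem hγ hy
  have hv' := rpow_neg_one_div_mem hγ' hy
  -- For large y the argument is below 1/2, so monotonicity keeps the weight away from zero and the
  -- powers of y decide.
  have hlow : J (1 / 2) ≤ J (y ^ (-1 / γ')) := by
    refine hJ.antitoneOn hv' (by norm_num) ?_
    rw [neg_div]
    exact hy2.le
  have hup : J (y ^ (-1 / γ)) ≤ C := le_of_abs_le (hC _ hv).1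
  have hsplit : y ^ (-1 - 1 / γ) = y ^ (-(1 / γ - 1 / γ')) * y ^ (-1 - 1 / γ') := by
    rw [← Real.rpow_add hy0]
    congr 1
    ring
  have hpos : 0 < y ^ (-1 - 1 / γ') := Real.rpow_pos_of_pos hy0 _
  have hpos' : 0 < y ^ (-(1 / γ - 1 / γ')) := Real.rpow_pos_of_pos hy0 _
  simp only [weightedDensity, paretoDensity]
  calc J (y ^ (-1 / γ)) * (γ⁻¹ * y ^ (-1 - 1 / γ))
      ≤ C * (γ⁻¹ * y ^ (-1 - 1 / γ)) := by gcongr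
    _ = C * γ⁻¹ * y ^ (-(1 / γ - 1 / γ')) * y ^ (-1 - 1 / γ') := by rw [hsplit]; ring
    _ < J (1 / 2) * γ'⁻¹ * y ^ (-1 - 1 / γ') := by gcongr
    _ ≤ J (y ^ (-1 / γ')) * (γ'⁻¹ * y ^ (-1 - 1 / γ')) := by
      rw [mul_assoc]
      gcongr

theorem eventually_weightedDensity_ne (hJ : AdmissibleWeight J) {γ γ' : ℝ} (hγ : 0 < γ)
    (hγ' : 0 < γ') (hne : γ ≠ γ') :
    ∀ᶠ y in atTop, weightedDensity J γ y ≠ weightedDensity J γ' y := by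
  rcases hne.lt_or_gt with h | h
  · exact (eventually_weightedDensity_lt hJ hγ h).mono fun _ => ne_of_lt
  · exact (eventually_weightedDensity_lt hJ hγ' h).mono fun _ => ne_of_gt

/-- For positive a and b, a b ^ α ≤ max(a, b) ^ (1 + α) ≤ a ^ (1 + α) + b ^ (1 + α). -/
theorem integrableOn_weightedDensity_mul_rpow (hJ : AdmissibleWeight J) {γ₀ γ α : ℝ}
    (hγ₀ : 0 < γ₀) (hγ : 0 < γ) (hα : 0 < α) :
    IntegrableOn (fun y => weightedDensity J γ₀ y * weightedDensity J γ y ^ α) (Set.Ioi 1) := by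
  have h := (integrableOn_weightedDensity_rpow hJ hγ₀ hα).add
    (integrableOn_weightedDensity_rpow hJ hγ hα)
  refine Integrable.mono' h (((continuousOn_weightedDensity hJ hγ₀).mul
    (continuousOn_weightedDensity_rpow hJ hγ α)).aestronglyMeasurable measurableSet_Ioi) ?_
  filter_upwards [ae_restrict_mem measurableSet_Ioi] with y hy
  have ha := weightedDensity_pos hJ hγ₀ hy
  have hb := weightedDensity_pos hJ hγ hy
  have ha' := Real.rpow_pos_of_pos ha α
  have hb' := Real.rpow_pos_of_pos hb α
  rw [Real.norm_of_nonneg (by positivity), Pi.add_apply, Real.rpow_add ha, Real.rpow_add hb,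
    Real.rpow_one, Real.rpow_one]
  rcases le_total (weightedDensity J γ₀ y) (weightedDensity J γ y) with hle | hle
  · have h1 : weightedDensity J γ₀ y * weightedDensity J γ y ^ α ≤
      weightedDensity J γ y * weightedDensity J γ y ^ α := by gcongr
    have h2 := mul_pos ha ha'
    linarith
  · have h1 : weightedDensity J γ₀ y * weightedDensity J γ y ^ α ≤
      weightedDensity J γ₀ y * weightedDensity J γ₀ y ^ α := by gcongr
    have h2 := mul_pos hb hb'
    linarith

/-- The true index is the unique maximizer of the population criterion. -/
theorem population_criterion_lt (hJ : AdmissibleWeight J) {γ₀ γ α : ℝ} (hγ₀ : 0 < γ₀)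
    (hγ : 0 < γ) (hα : 0 < α) (hne : γ ≠ γ₀) :
    (∫ y in Set.Ioi 1, weightedDensity J γ₀ y * weightedDensity J γ y ^ α)
        - α / (α + 1) * ∫ y in Set.Ioi 1, weightedDensity J γ y ^ (1 + α)
      < (∫ y in Set.Ioi 1, weightedDensity J γ₀ y * weightedDensity J γ₀ y ^ α)
        - α / (α + 1) * ∫ y in Set.Ioi 1, weightedDensity J γ₀ y ^ (1 + α) := by
  have hi : ∀ g, 0 < g → IntegrableOn (fun y => weightedDensity J γ₀ y * weightedDensity J g y ^ α
      - α / (α + 1) * weightedDensity J g y ^ (1 + α)) (Set.Ioi 1) := fun g hg =>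
    (integrableOn_weightedDensity_mul_rpow hJ hγ₀ hg hα).sub
      ((integrableOn_weightedDensity_rpow hJ hg hα).const_mul _)
  have he : ∀ g, 0 < g → (∫ y in Set.Ioi 1, weightedDensity J γ₀ y * weightedDensity J g y ^ α)
        - α / (α + 1) * ∫ y in Set.Ioi 1, weightedDensity J g y ^ (1 + α)
      = ∫ y in Set.Ioi 1, (weightedDensity J γ₀ y * weightedDensity J g y ^ α
      - α / (α + 1) * weightedDensity J g y ^ (1 + α)) := fun g hg => by
    rw [integral_sub (integrableOn_weightedDensity_mul_rpow hJ hγ₀ hg hα)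
      ((integrableOn_weightedDensity_rpow hJ hg hα).const_mul _), integral_const_mul]
  rw [he γ hγ, he γ₀ hγ₀, ← sub_pos, ← integral_sub (hi γ₀ hγ₀) (hi γ hγ)]
  refine (integral_pos_iff_support_of_nonneg_ae ?_ ((hi γ₀ hγ₀).sub (hi γ hγ))).mpr ?_
  · filter_upwards [ae_restrict_mem measurableSet_Ioi] with y hy
    exact sub_nonneg.mpr (density_power_le (weightedDensity_pos hJ hγ₀ hy)
      (weightedDensity_pos hJ hγ hy) hα)
  -- Strictness needs the densities to differ only on a set of positive measure; a half-line
  -- suffices.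
  · obtain ⟨M, hM⟩ := eventually_atTop.mp (eventually_weightedDensity_ne hJ hγ₀ hγ hne.symm)
    have hsub : Set.Ioi (max M 1) ⊆ Function.support (fun y =>
        weightedDensity J γ₀ y * weightedDensity J γ₀ y ^ α
          - α / (α + 1) * weightedDensity J γ₀ y ^ (1 + α)
        - (weightedDensity J γ₀ y * weightedDensity J γ y ^ α
          - α / (α + 1) * weightedDensity J γ y ^ (1 + α))) := by
      intro y hy
      obtain ⟨hyM, hy1⟩ := max_lt_iff.mp (Set.mem_Ioi.mp hy)
      exact (sub_pos.mpr (density_power_lt (weightedDensity_pos hJ hγ₀ hy1)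
        (weightedDensity_pos hJ hγ hy1) hα (hM y hyM.le))).ne'
    refine lt_of_lt_of_le ?_ (measure_mono hsub)
    rw [Measure.restrict_apply measurableSet_Ioi, Set.inter_eq_left.mpr
      (Set.Ioi_subset_Ioi (le_max_right M 1)), Real.volume_Ioi]
    exact ENNReal.zero_lt_top

theorem image_rpow_neg_one_div {γ : ℝ} (hγ : 0 < γ) :
    (fun y : ℝ => y ^ (-1 / γ)) '' Set.Ioi 1 = Set.Ioo 0 1 := by
  ext s
  constructor
  · rintro ⟨y, hy, rfl⟩
    exact rpow_neg_one_div_mem hγ hy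
  · intro hs
    refine ⟨s ^ (-γ), Real.one_lt_rpow_of_pos_of_lt_one_of_neg hs.1 hs.2 (by linarith), ?_⟩
    simp only
    rw [← Real.rpow_mul hs.1.le]
    simp [hγ.ne', neg_div]

/-- The substitution `s = y ^ (-1 / γ)`. -/
theorem integral_weight_mul_comp_rpow {γ : ℝ} (hγ : 0 < γ) (h : ℝ → ℝ) :
    ∫ s in Set.Ioo (0 : ℝ) 1, J s * h (s ^ (-γ))
      = ∫ y in Set.Ioi (1 : ℝ), weightedDensity J γ y * h y := by
  have hd : ∀ y ∈ Set.Ioi (1 : ℝ), HasDerivWithinAt (fun y : ℝ => y ^ (-1 / γ))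
      (-1 / γ * y ^ (-1 / γ - 1)) (Set.Ioi 1) y := by
    intro y hy
    have : (1 : ℝ) < y := hy
    exact (Real.hasDerivAt_rpow_const (Or.inl (by linarith))).hasDerivWithinAt
  have hinv : ∀ y ∈ Set.Ioi (1 : ℝ), (y ^ (-1 / γ)) ^ (-γ) = y := by
    intro y hy
    have : (1 : ℝ) < y := hy
    rw [← Real.rpow_mul (by linarith)]
    simp [hγ.ne', neg_div]
  have hinj : Set.InjOn (fun y : ℝ => y ^ (-1 / γ)) (Set.Ioi 1) := by
    intro y hy z hz hyz
    rw [← hinv y hy, ← hinv z hz]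
    exact congrArg (· ^ (-γ)) hyz
  rw [← image_rpow_neg_one_div hγ, integral_image_eq_integral_abs_deriv_smul measurableSet_Ioi hd
    hinj]
  refine setIntegral_congr_fun measurableSet_Ioi fun y hy => ?_
  have hy0 : 0 < y := by
    have : (1 : ℝ) < y := hy
    linarith
  -- The substitution is the Pareto survival function, so its Jacobian is the Pareto density.
  have habs : |-1 / γ * y ^ (-1 / γ - 1)| = paretoDensity γ y := by
    rw [abs_mul, abs_of_pos (Real.rpow_pos_of_pos hy0 _), abs_div, abs_neg, abs_one,
      abs_of_pos hγ, one_div, paretoDensity]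
    congr 2
    ring
  simp only [habs, hinv y hy, weightedDensity, smul_eq_mul]
  ring

end Population

/-! ### The sample criterion -/

/-- The objective function whose critical points solve the estimating equation. -/
noncomputable def criterion (J : ℝ → ℝ) (α : ℝ) (k : ℕ) {n : ℕ} (x : Fin n → ℝ) (g : ℝ) : ℝ :=
  1 / (k : ℝ) * ∑ i ∈ Finset.Icc 1 k, J ((i : ℝ) / ((k : ℝ) + 1)) *
      weightedDensity J g (max 1 (relExcess x k i)) ^ α
    - α / (α + 1) * ∫ y in Set.Ioi (1 : ℝ), weightedDensity J g y ^ (1 + α)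

section Criterion

variable {J : ℝ → ℝ} {α : ℝ}

/-- Truncating the excesses at 1 makes this valid for every sample, including those with a
nonpositive denominator, so a maximizer can be selected on the whole sample space. -/
theorem hasDerivAt_criterion (hJ : AdmissibleWeight J) (hα : 0 < α) (k : ℕ) {n : ℕ}
    (x : Fin n → ℝ) {γ : ℝ} (hγ : 0 < γ) :
    HasDerivAt (criterion J α k x)
      (1 / (k : ℝ) * ∑ i ∈ Finset.Icc 1 k, J ((i : ℝ) / ((k : ℝ) + 1)) *
          deriv (fun g : ℝ => weightedDensity J g (max 1 (relExcess x k i)) ^ α) γ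
        - α / (α + 1) *
          ∫ y in Set.Ioi (1 : ℝ), deriv (fun g : ℝ => weightedDensity J g y ^ (1 + α)) γ) γ := by
  refine HasDerivAt.sub (HasDerivAt.const_mul _ (HasDerivAt.fun_sum fun i _ =>
    HasDerivAt.const_mul _ ?_)) ((hasDerivAt_integral_weightedDensity_rpow hJ hγ hα).2.const_mul _)
  exact (differentiableAt_weightedDensity_rpow hJ hγ (le_max_left _ _)).hasDerivAt

/-- Fermat's rule; the truncation is inactive when all excesses are at least 1. -/
theorem isRoot_of_isLocalMax (hJ : AdmissibleWeight J) (hα : 0 < α) {k n : ℕ} {x : Fin n → ℝ}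
    {γ : ℝ} (hγ : 0 < γ) (hx : ∀ i ∈ Finset.Icc 1 k, 1 ≤ relExcess x k i)
    (hmax : IsLocalMax (criterion J α k x) γ) : IsRoot J α k x γ where
  pos := hγ
  differentiable_left i hi := differentiableAt_weightedDensity_rpow hJ hγ (hx i hi)
  differentiable_right y hy := differentiableAt_weightedDensity_rpow hJ hγ hy.le
  integrable_right := (hasDerivAt_integral_weightedDensity_rpow hJ hγ hα).1
  equation := by
    have h := hmax.hasDerivAt_eq_zero (hasDerivAt_criterion hJ hα k x hγ)
    rw [sub_eq_zero] at h
    rw [← h]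
    congr 1
    exact Finset.sum_congr rfl fun i hi => by rw [max_eq_right (hx i hi)]

/-- `J` may be wild outside (0, 1), but the truncated function is constant below 1 and continuous
above 1, so only one point is exceptional. -/
theorem measurable_weightedDensity_max (hJ : AdmissibleWeight J) {γ : ℝ} (hγ : 0 < γ) :
    Measurable fun y => weightedDensity J γ (max 1 y) ^ α := by
  have : Measurable fun y => weightedDensity J γ (max 1 y) := by
    refine measurable_of_continuousOn_compl_singleton 1 fun y hy =>
      ContinuousAt.continuousWithinAt ?_
    rcases lt_or_gt_of_ne (show y ≠ 1 from hy) with h | h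
    · refine (continuousAt_const (y := weightedDensity J γ 1)).congr ?_
      filter_upwards [Iio_mem_nhds h] with z hz
      rw [max_eq_left (le_of_lt hz)]
    · refine ((continuousOn_weightedDensity hJ hγ).continuousAt (Ioi_mem_nhds h)).congr ?_
      filter_upwards [Ioi_mem_nhds h] with z hz
      rw [max_eq_right (le_of_lt hz)]
  exact this.pow_const α

theorem measurable_criterion (hJ : AdmissibleWeight J) (k n : ℕ) {γ : ℝ} (hγ : 0 < γ) :
    Measurable fun x : Fin n → ℝ => criterion J α k x γ := by
  refine Measurable.sub_const (Measurable.const_mul (Finset.measurable_sum _ fun i _ =>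
    Measurable.const_mul ?_ _) _) _
  exact (measurable_weightedDensity_max hJ hγ).comp (measurable_relExcess n k i)

/-- The criterion converges in probability to the population criterion. -/
theorem convergesInProb_criterion {Ω : Type*} [MeasurableSpace Ω] {μ : Measure Ω}
    [IsProbabilityMeasure μ] {X : ℕ → Ω → ℝ} (hX_meas : ∀ i, Measurable (X i))
    (hX_indep : iIndepFun X μ) (hX_ident : ∀ i, IdentDistrib (X i) (X 0) μ μ) {γ₀ : ℝ}
    (hγ₀ : 0 < γ₀) (hF : RegularlyVarying (tail μ (X 0)) (-1 / γ₀)) (hJ : AdmissibleWeight J)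
    {k : ℕ → ℕ} (hk : Tendsto k atTop atTop)
    (hkn : Tendsto (fun n : ℕ => (k n : ℝ) / (n : ℝ)) atTop (𝓝 0)) (hα : 0 < α) {γ : ℝ}
    (hγ : 0 < γ) :
    ConvergesInProb μ (fun n ω => criterion J α (k n) (fun j : Fin n => X j ω) γ)
      ((∫ y in Set.Ioi 1, weightedDensity J γ₀ y * weightedDensity J γ y ^ α)
        - α / (α + 1) * ∫ y in Set.Ioi 1, weightedDensity J γ y ^ (1 + α)) := by
  obtain ⟨C, -, hC⟩ := hJ.exists_bound
  obtain ⟨K, hK⟩ := exists_bound_weightedDensity_rpow hJ hγ hα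
  -- The second entry of `B` covers y ≤ 1, where the truncation evaluates the arbitrary value `J 1`.
  have h := convergesInProb_average hX_meas hX_indep hX_ident hγ₀ hF hk hkn hJ.continuousOn
    (C := C) (fun s hs => (hC s hs).1) (measurable_weightedDensity_max (α := α) hJ hγ)
    (B := max K |weightedDensity J γ 1 ^ α|) ?_ ?_
  · rw [integral_weight_mul_comp_rpow hγ₀ fun y => weightedDensity J γ (max 1 y) ^ α] at h
    have he : ∫ y in Set.Ioi (1 : ℝ), weightedDensity J γ₀ y * weightedDensity J γ (max 1 y) ^ α
        = ∫ y in Set.Ioi 1, weightedDensity J γ₀ y * weightedDensity J γ y ^ α :=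
      setIntegral_congr_fun measurableSet_Ioi fun y hy => by
        simp only [max_eq_right (le_of_lt (Set.mem_Ioi.mp hy))]
    rw [he] at h
    exact h.comp (f := fun t => t - α / (α + 1) *
      ∫ y in Set.Ioi (1 : ℝ), weightedDensity J γ y ^ (1 + α)) (by fun_prop)
  · intro y hy
    refine ((continuousOn_weightedDensity_rpow hJ hγ α).continuousAt (Ioi_mem_nhds hy)).congr ?_
    filter_upwards [Ioi_mem_nhds hy] with z hz
    rw [max_eq_right (le_of_lt hz)]
  · intro y
    rcases le_or_gt y 1 with hy | hy
    · rw [max_eq_left hy]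
      exact le_max_right _ _
    · rw [max_eq_right hy.le, abs_of_pos (Real.rpow_pos_of_pos (weightedDensity_pos hJ hγ hy) _)]
      exact (hK γ (mem_Ioo_half_double hγ) y hy).1.trans (le_max_left _ _)

end Criterion

/-! ### Measurable selection and the diagonal argument -/

/-- The running maximum of a function which is continuous in a real parameter is measurable. -/
theorem exists_measurable_running_max {E : Type*} [MeasurableSpace E] {f : E → ℝ → ℝ} {a c : ℝ}
    (hac : a ≤ c) (hm : ∀ g ∈ Set.Icc a c, Measurable fun x => f x g)
    (hc : ∀ x, ContinuousOn (f x) (Set.Icc a c)) :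
    ∃ M : E → ℝ, Measurable M ∧
      ∀ x, (∀ g ∈ Set.Icc a c, f x g ≤ M x) ∧ ∃ g ∈ Set.Icc a c, f x g = M x := by
  have hproj : ∀ u : ℝ, max a (min c u) ∈ Set.Icc a c := fun u =>
    ⟨le_max_left _ _, max_le hac (min_le_left _ _)⟩
  -- Clamping the rationals into the interval gives a countable dense family that works even when a
  -- = c is irrational.
  refine ⟨fun x => ⨆ q : ℚ, f x (max a (min c q)), Measurable.iSup fun q => hm _ (hproj _),
    fun x => ?_⟩
  obtain ⟨g, hg, hgmax⟩ := isCompact_Icc.exists_isMaxOn (Set.nonempty_Icc.mpr hac) (hc x)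
  have hbdd : BddAbove (Set.range fun q : ℚ => f x (max a (min c q))) :=
    ⟨f x g, by rintro _ ⟨q, rfl⟩; exact hgmax (hproj q)⟩
  have hcont : Continuous fun u : ℝ => f x (max a (min c u)) :=
    (hc x).comp_continuous (by fun_prop) hproj
  have hle : ∀ u : ℝ, f x (max a (min c u)) ≤ ⨆ q : ℚ, f x (max a (min c q)) :=
    isClosed_property Rat.denseRange_cast (isClosed_le hcont continuous_const)
      fun q => le_ciSup hbdd q
  have hle' : ∀ g ∈ Set.Icc a c, f x g ≤ ⨆ q : ℚ, f x (max a (min c q)) := fun g hg => by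
    have := hle g
    rwa [min_eq_right hg.2, max_eq_right hg.1] at this
  exact ⟨hle', g, hg, le_antisymm (hle' g hg) (ciSup_le fun q => hgmax (hproj q))⟩

/-- Measurable selection of a maximizer over a compact interval. -/
theorem exists_measurable_argmax {E : Type*} [MeasurableSpace E] {f : E → ℝ → ℝ} {a b : ℝ}
    (hab : a ≤ b) (hm : ∀ g ∈ Set.Icc a b, Measurable fun x => f x g)
    (hc : ∀ x, ContinuousOn (f x) (Set.Icc a b)) :
    ∃ τ : E → ℝ, Measurable τ ∧ ∀ x, τ x ∈ Set.Icc a b ∧ IsMaxOn (f x) (Set.Icc a b) (τ x) := by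
  let A : E → Set ℝ := fun x => {g ∈ Set.Icc a b | IsMaxOn (f x) (Set.Icc a b) g}
  have hAmem : ∀ x, sInf (A x) ∈ A x := by
    intro x
    obtain ⟨g, hg, hgmax⟩ := isCompact_Icc.exists_isMaxOn (Set.nonempty_Icc.mpr hab) (hc x)
    have hA : A x = Set.Icc a b ∩ f x ⁻¹' Set.Ici (f x g) := by
      ext g'
      refine and_congr_right fun hg' => ⟨fun h => h hg, fun h z hz => ?_⟩
      exact (hgmax hz : f x z ≤ f x g).trans (show f x g ≤ f x g' from h)
    have hcl : IsClosed (A x) := by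
      rw [hA]
      exact (hc x).preimage_isClosed_of_isClosed isClosed_Icc isClosed_Ici
    exact (isCompact_Icc.of_isClosed_subset hcl fun g hg => hg.1).sInf_mem ⟨g, hg, hgmax⟩
  refine ⟨fun x => sInf (A x), measurable_of_Iic fun c => ?_, fun x => hAmem x⟩
  rcases lt_or_ge c a with hca | hca
  · convert MeasurableSet.empty
    ext x
    simpa using hca.trans_le (hAmem x).1.1
  -- The least maximizer is at most c exactly when the maximum over [a, d] reaches the one over [a,
  -- b], a comparison of two measurable functions.
  · set d := min c b with hd
    have had : a ≤ d := le_min hca hab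
    have hdb : Set.Icc a d ⊆ Set.Icc a b := Set.Icc_subset_Icc_right (min_le_right _ _)
    obtain ⟨M, hM, hMf⟩ := exists_measurable_running_max hab hm hc
    obtain ⟨N, hN, hNf⟩ := exists_measurable_running_max had (fun g hg => hm g (hdb hg))
      fun x => (hc x).mono hdb
    convert measurableSet_le hM hN
    ext x
    simp only [Set.mem_preimage, Set.mem_Iic, Set.mem_ofPred_eq]
    obtain ⟨g, hg, hgM⟩ := (hMf x).2
    obtain ⟨g', hg', hgN⟩ := (hNf x).2
    constructor
    · intro h
      rw [← hgM]
      exact ((hAmem x).2 hg : f x g ≤ _).trans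
        ((hNf x).1 _ ⟨(hAmem x).1.1, le_min h (hAmem x).1.2⟩)
    · intro h
      have hA : g' ∈ A x := ⟨hdb hg', fun z hz => ((hMf x).1 z hz).trans (h.trans_eq hgN.symm)⟩
      exact (csInf_le ⟨a, fun z hz => hz.1.1⟩ hA).trans (hg'.2.trans (min_le_left _ _))

/-- A diagonal sequence along which a family of null sequences still tends to zero. -/
theorem exists_diagonal_tendsto_zero {p : ℕ → ℕ → ENNReal}
    (hp : ∀ m, Tendsto (p m) atTop (𝓝 0)) :
    ∃ φ : ℕ → ℕ, Tendsto φ atTop atTop ∧ Tendsto (fun n => p (φ n) n) atTop (𝓝 0) := by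
  classical
  -- The diagonal index at n is the largest m ≤ n with `P n m`; m = 0 always qualifies, as its bound
  -- is infinite.
  let P : ℕ → ℕ → Prop := fun n m => ∀ j, n ≤ j → p m j ≤ (m : ENNReal)⁻¹
  have hφ : Tendsto (fun n => Nat.findGreatest (P n) n) atTop atTop := by
    refine tendsto_atTop.mpr fun m => ?_
    obtain ⟨N, hN⟩ := eventually_atTop.mp
      ((hp m).eventually_le_const (ENNReal.inv_pos.mpr (ENNReal.natCast_ne_top m)))
    filter_upwards [eventually_ge_atTop N, eventually_ge_atTop m] with n hn hnm
    exact Nat.le_findGreatest hnm fun j hj => hN j (hn.trans hj)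
  refine ⟨_, hφ, tendsto_of_tendsto_of_tendsto_of_le_of_le' tendsto_const_nhds
    (ENNReal.tendsto_inv_nat_nhds_zero.comp hφ) (Eventually.of_forall fun _ => zero_le) ?_⟩
  filter_upwards [hφ.eventually_gt_atTop 0] with n hn
  exact (Nat.findGreatest_of_ne_zero (P := P n) rfl hn.ne') n le_rfl

/-- With probability tending to one, all the relative excesses are well defined. -/
theorem tendsto_measure_not_one_le_relExcess {Ω : Type*} [MeasurableSpace Ω] {μ : Measure Ω}
    [IsProbabilityMeasure μ] {X : ℕ → Ω → ℝ} (hX_meas : ∀ i, Measurable (X i))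
    (hX_indep : iIndepFun X μ) (hX_ident : ∀ i, IdentDistrib (X i) (X 0) μ μ) {γ₀ : ℝ}
    (hγ₀ : 0 < γ₀) (hF : RegularlyVarying (tail μ (X 0)) (-1 / γ₀))
    {k : ℕ → ℕ} (hk : Tendsto k atTop atTop)
    (hkn : Tendsto (fun n : ℕ => (k n : ℝ) / (n : ℝ)) atTop (𝓝 0)) :
    Tendsto (fun n : ℕ => μ {ω | ¬ ∀ i ∈ Finset.Icc 1 (k n),
      1 ≤ relExcess (fun j : Fin n => X j ω) (k n) i}) atTop (𝓝 0) := by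
  obtain ⟨b, hbpos, hb⟩ := exists_scale hX_meas hX_indep hX_ident hγ₀ hF hk hkn
  have hkn' := eventually_lt_of_tendsto_div hkn
  have hlim1 := tendsto_succ_div_self hk
  have hden := hb (fun n => k n + 1) 1 one_pos
    (by filter_upwards [hkn'] with n hn; omega) hlim1
  rw [Real.one_rpow] at hden
  -- The denominator divided by b n tends to 1, so it is positive with probability tending to one;
  -- sorting does the rest.
  refine tendsto_measure_zero_of_subset ?_ (hden _ (Ioi_mem_nhds zero_lt_one))
  filter_upwards [hkn', hbpos] with n hn hbn ω hω hpos
  refine hω fun i hi => ?_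
  rw [Finset.mem_Icc] at hi
  refine one_le_relExcess _ hn hi.1 hi.2 ?_
  rw [Set.mem_Ioi, show n + 1 - (k n + 1) = n - k n by omega] at hpos
  exact (div_pos_iff_of_pos_right hbn).mp hpos

end WMDPD

/-! ### Existence and consistency of the estimator -/

theorem theorem1 {Ω : Type*} [MeasurableSpace Ω] (μ : Measure Ω) [IsProbabilityMeasure μ]
    (X : ℕ → Ω → ℝ) (hX_meas : ∀ i, Measurable (X i)) (hX_nonneg : ∀ i, ∀ᵐ ω ∂μ, 0 ≤ X i ω)
    (hX_indep : iIndepFun X μ) (hX_ident : ∀ i, IdentDistrib (X i) (X 0) μ μ)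
    (γ₀ : ℝ) (hγ₀ : 0 < γ₀) (hF : WMDPD.RegularlyVarying (WMDPD.tail μ (X 0)) (-1 / γ₀))
    (J : ℝ → ℝ) (hJ : WMDPD.AdmissibleWeight J)
    (k : ℕ → ℕ) (hk : Tendsto k atTop atTop)
    (hkn : Tendsto (fun n : ℕ => (k n : ℝ) / (n : ℝ)) atTop (𝓝 0))
    (α : ℝ) (hα : 0 < α) :
    ∃ γhat : (n : ℕ) → (Fin n → ℝ) → ℝ,
      (∀ n, Measurable (γhat n)) ∧
      Tendsto (fun n : ℕ => μ {ω | ¬ WMDPD.IsRoot J α (k n) (fun i : Fin n => X i ω)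
        (γhat n (fun i : Fin n => X i ω))}) atTop (𝓝 0) ∧
      TendstoInMeasure μ (fun (n : ℕ) (ω : Ω) => γhat n (fun i : Fin n => X i ω)) atTop
        (fun _ => γ₀) := by
  -- Null half-widths below γ₀, so that every interval stays in the positive parameters.
  let e : ℕ → ℝ := fun m => γ₀ / (m + 2)
  have he0 : ∀ m, 0 < e m := fun m => by positivity
  have heγ : ∀ m, e m < γ₀ := fun m => by
    rw [div_lt_iff₀ (by positivity)]
    have : (0 : ℝ) ≤ m := m.cast_nonneg
    nlinarith
  have helim : Tendsto e atTop (𝓝 0) :=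
    tendsto_const_nhds.div_atTop (tendsto_atTop_add_const_right _ _ tendsto_natCast_atTop_atTop)
  let crit : (n : ℕ) → ℝ → Ω → ℝ := fun n g ω =>
    WMDPD.criterion J α (k n) (fun j : Fin n => X j ω) g
  -- the criterion is smaller away from the true index
  have hsep : ∀ g, 0 < g → g ≠ γ₀ →
      Tendsto (fun n => μ {ω | ¬ crit n g ω < crit n γ₀ ω}) atTop (𝓝 0) := by
    intro g hg hne
    have h := (WMDPD.convergesInProb_criterion hX_meas hX_indep hX_ident hγ₀ hF hJ hk hkn hα
      hg).prodMk (WMDPD.convergesInProb_criterion hX_meas hX_indep hX_ident hγ₀ hF hJ hk hkn hα hγ₀)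
    exact h {q | q.1 < q.2} ((isOpen_lt continuous_fst continuous_snd).mem_nhds
      (WMDPD.population_criterion_lt hJ hγ₀ hg hα hne))
  let bad : ℕ → ℕ → Set Ω := fun m n =>
    ({ω | ¬ crit n (γ₀ - e m) ω < crit n γ₀ ω} ∪ {ω | ¬ crit n (γ₀ + e m) ω < crit n γ₀ ω}) ∪
      {ω | ¬ ∀ i ∈ Finset.Icc 1 (k n), 1 ≤ WMDPD.relExcess (fun j : Fin n => X j ω) (k n) i}
  have hbad : ∀ m, Tendsto (fun n => μ (bad m n)) atTop (𝓝 0) := fun m =>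
    WMDPD.tendsto_measure_zero_union (WMDPD.tendsto_measure_zero_union
      (hsep _ (by linarith [heγ m]) (by linarith [he0 m] : γ₀ - e m < γ₀).ne)
      (hsep _ (by linarith [he0 m]) (by linarith [he0 m] : γ₀ < γ₀ + e m).ne'))
      (WMDPD.tendsto_measure_not_one_le_relExcess hX_meas hX_indep hX_ident hγ₀ hF hk hkn)
  obtain ⟨φ, hφ, hφbad⟩ := WMDPD.exists_diagonal_tendsto_zero hbad
  have hpos : ∀ m, ∀ g ∈ Set.Icc (γ₀ - e m) (γ₀ + e m), 0 < g := fun m g hg => by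
    linarith [heγ m, hg.1]
  have hsel := fun n => WMDPD.exists_measurable_argmax (E := Fin n → ℝ)
    (f := fun x g => WMDPD.criterion J α (k n) x g)
    (a := γ₀ - e (φ n)) (b := γ₀ + e (φ n)) (by linarith [he0 (φ n)])
    (fun g hg => WMDPD.measurable_criterion hJ (k n) n (hpos _ g hg))
    (fun x g hg =>
      (WMDPD.hasDerivAt_criterion hJ hα (k n) x (hpos _ g hg)).continuousAt.continuousWithinAt)
  choose γhat hmeas hmax using hsel
  refine ⟨γhat, hmeas, ?_, ?_⟩
  · refine WMDPD.tendsto_measure_zero_of_subset (Eventually.of_forall fun n ω hω => ?_) hφbad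
    by_contra hgood
    simp only [bad, Set.mem_union, Set.mem_ofPred_eq, not_or, not_not] at hgood
    obtain ⟨⟨h1, h2⟩, h3⟩ := hgood
    obtain ⟨hmem, hmx⟩ := hmax n (fun i : Fin n => X i ω)
    have h0 := hmx (show γ₀ ∈ Set.Icc (γ₀ - e (φ n)) (γ₀ + e (φ n)) from
      ⟨by linarith [he0 (φ n)], by linarith [he0 (φ n)]⟩)
    -- A maximizer at an endpoint would make the criterion there at least its value at γ₀, which is
    -- excluded off the bad event.
    refine hω (WMDPD.isRoot_of_isLocalMax hJ hα (hpos _ _ hmem) h3 (hmx.isLocalMax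
      (Icc_mem_nhds (hmem.1.lt_of_ne fun h => ?_) (hmem.2.lt_of_ne fun h => ?_))))
    · rw [← h] at h0
      exact absurd h1 (not_lt.mpr h0)
    · rw [h] at h0
      exact absurd h2 (not_lt.mpr h0)
  -- The estimator lies within e (φ n) of γ₀ for every outcome, so the events in question are
  -- eventually empty.
  · rw [tendstoInMeasure_iff_dist]
    intro ε hε
    refine tendsto_const_nhds.congr' ?_
    filter_upwards [(helim.comp hφ).eventually_lt_const hε] with n hn
    symm
    convert measure_empty (μ := μ)
    ext ω
    obtain ⟨hmem, -⟩ := hmax n (fun i : Fin n => X i ω)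
    simp only [Set.mem_ofPred_eq, Set.mem_empty_iff_false, iff_false, not_le, Real.dist_eq]
    refine lt_of_le_of_lt (abs_le.mpr ⟨?_, ?_⟩) hn
    · simp only [Function.comp]
      linarith [hmem.1]
    · simp only [Function.comp]
      linarith [hmem.2]
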